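/- All Lie algebras and modules are finite dimensional over $\mathbb{C}$. Let $\mathfrak g=\mathfrak s\ltimes\mathfrak r$ be a Levi decomposition, where $\mathfrak r$ is the solvable radical of $\mathfrak g$ and $\mathfrak s$ is a semisimple subalgebra, and let $W_1,\dots,W_n$ ($n\ge 1$) be a sequence of irreducible $\mathfrak s$-modules. Definitions. A $\mathfrak g$-module $V$ is uniserial if its submodules form a chain. Its socle series is given by $\mathrm{soc}^0(V)=0$ and $\mathrm{soc}^{i}(V)/\mathrm{soc}^{i-1}(V)=$ the socle (the sum of all irreducible submodules) of $V/\mathrm{soc}^{i-1}(V)$; these quotients, for $1\le i\le m$ where $m$ is least with $\mathrm{soc}^m(V)=V$, are the socle factors of $V$. The sequence $W_1,\dots,W_n$ is admissible if there is a uniserial $\mathfrak g$-module whose socle factors are, in this order, isomorphic as $\mathfrak s$-modules to $W_1,\dots,W_n$. Two $\mathfrak s$-modules are disjoint if no irreducible submodule of one is isomorphic to a submodule of the other, i.e. they have no common irreducible constituent. (a) Suppose $W_1,\dots,W_n$ is admissible. Then $\mathfrak r$ is not disjoint from any of the $\mathfrak s$-modules $W_2^*\otimes W_1,\dots,W_n^*\otimes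 W_{n-1}$. In particular, if $\mathfrak r$ is an irreducible $\mathfrak s$-module, then it is isomorphic to a submodule of each of $W_2^*\otimes W_1,\dots,W_n^*\otimes W_{n-1}$. (b) Assume that $\mathfrak g$ is perfect ($[\mathfrak g,\mathfrak g]=\mathfrak g$) and that $\mathfrak r$ is abelian. Then $W_1,\dots,W_n$ is admissible if and only if $\mathfrak r$ is not disjoint from any of $W_2^*\otimes W_1,\dots,W_n^*\otimes W_{n-1}$ and, for some choice of non-zero $\mathfrak s$-homomorphisms $f_{i+1,i}:\mathfrak r\to\mathrm{Hom}(W_{i+1},W_i)$, $1\le i<n$, the Lie subalgebra of $\mathfrak{gl}(V)$, $V=W_1\oplus\cdots\oplus W_n$, generated by the elements $f_{2,1}(r)+\cdots+f_{n,n-1}(r)$, $r\in\mathfrak r$, is abelian (here a linear map $W_{i+1}\to W_i$ is viewed as an endomorphism of $V$ that is zero on all other summands). In particular, if $\Lambda^2\mathfrak r$ is disjoint from each of $W_3^*\otimes W_1,\dots,W_n^*\otimes W_{n-2}$ and $\mathfrak r$ is not disjoint from any of $W_2^*\otimes W_1,\dots,W_n^*\otimes W_{n-1}$, then $W_1,\dots,W_n$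 is admissible. -/

import Mathlib

open scoped TensorProduct

/-! ### The second exterior power of a Lie module -/

namespace LieExteriorSquare

variable (R : Type*) {L M : Type*} [CommRing R] [LieRing L] [LieAlgebra R L]
  [AddCommGroup M] [Module R M] [LieRingModule L M] [LieModule R L M]

theorem wedge_add_left (p q r : M) : exteriorPower.ιMulti R 2 ![p + q, r] =
    exteriorPower.ιMulti R 2 ![p, r] + exteriorPower.ιMulti R 2 ![q, r] := by
  have e : ∀ x : M, Function.update ![p, r] 0 x = ![x, r] := by
    intro x; ext k; fin_cases k <;> simp
  have := (exteriorPower.ιMulti R 2 (M := M)).map_update_add ![p, r] 0 p q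
  rwa [e, e, e] at this

theorem wedge_add_right (p q r : M) : exteriorPower.ιMulti R 2 ![r, p + q] =
    exteriorPower.ιMulti R 2 ![r, p] + exteriorPower.ιMulti R 2 ![r, q] := by
  have e : ∀ x : M, Function.update ![r, p] 1 x = ![r, x] := by
    intro x; ext k; fin_cases k <;> simp
  have := (exteriorPower.ιMulti R 2 (M := M)).map_update_add ![r, p] 1 p q
  rwa [e, e, e] at this

theorem wedge_smul_left (c : R) (p r : M) : exteriorPower.ιMulti R 2 ![c • p, r] =
    c • exteriorPower.ιMulti R 2 ![p, r] := by
  have e : ∀ x : M, Function.update ![p, r] 0 x = ![x, r] := by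
    intro x; ext k; fin_cases k <;> simp
  have := (exteriorPower.ιMulti R 2 (M := M)).map_update_smul ![p, r] 0 c p
  rwa [e, e] at this

theorem wedge_smul_right (c : R) (p r : M) : exteriorPower.ιMulti R 2 ![r, c • p] =
    c • exteriorPower.ιMulti R 2 ![r, p] := by
  have e : ∀ x : M, Function.update ![r, p] 1 x = ![r, x] := by
    intro x; ext k; fin_cases k <;> simp
  have := (exteriorPower.ιMulti R 2 (M := M)).map_update_smul ![r, p] 1 c p
  rwa [e, e] at this

theorem wedge_neg_left (p q : M) : exteriorPower.ιMulti R 2 ![-p, q] =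
    - exteriorPower.ιMulti R 2 ![p, q] := by
  have := wedge_smul_left R (-1) p q
  rw [neg_one_smul] at this
  exact this.trans (neg_one_smul R (_ : ⋀[R]^2 M))

theorem wedge_neg_right (p q : M) : exteriorPower.ιMulti R 2 ![q, -p] =
    - exteriorPower.ιMulti R 2 ![q, p] := by
  have := wedge_smul_right R (-1) p q
  rw [neg_one_smul] at this
  exact this.trans (neg_one_smul R (_ : ⋀[R]^2 M))

/-- The alternating map `(v, w) ↦ ⁅x, v⁆ ∧ w + v ∧ ⁅x, w⁆`. -/
noncomputable def actAux (x : L) : M [⋀^Fin 2]→ₗ[R] ⋀[R]^2 M where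
  toFun v := exteriorPower.ιMulti R 2 ![⁅x, v 0⁆, v 1] + exteriorPower.ιMulti R 2 ![v 0, ⁅x, v 1⁆]
  map_update_add' := by
    intro _ v i a b
    fin_cases i <;>
      simp [wedge_add_left, wedge_add_right, Function.update] <;> abel
  map_update_smul' := by
    intro _ v i c a
    fin_cases i <;> simp [wedge_smul_left, wedge_smul_right, Function.update]
  map_eq_zero_of_eq' := by
    intro v i j hv hij
    have h01 : v 0 = v 1 := by
      fin_cases i <;> fin_cases j <;> simp_all
    have hs := (exteriorPower.ιMulti R 2 (M := M)).map_swap ![⁅x, v 1⁆, v 1]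
      (i := 0) (j := 1) (by decide)
    have hsw : (![⁅x, v 1⁆, v 1] ∘ ⇑(Equiv.swap (0 : Fin 2) 1)) = ![v 1, ⁅x, v 1⁆] := by
      ext k; fin_cases k <;> simp
    rw [hsw] at hs
    rw [h01, hs, add_neg_cancel]

/-- The action of `x` on `Λ²M`. -/
noncomputable def act (x : L) : (⋀[R]^2 M) →ₗ[R] (⋀[R]^2 M) :=
  exteriorPower.alternatingMapLinearEquiv (actAux R x)

theorem act_wedge (x : L) (v : Fin 2 → M) :
    act R x (exteriorPower.ιMulti R 2 v) =
      exteriorPower.ιMulti R 2 ![⁅x, v 0⁆, v 1] + exteriorPower.ιMulti R 2 ![v 0, ⁅x, v 1⁆] := by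
  simp [act, actAux]

/-- `Λ²M` as a module over the Lie algebra `L`, with `x · (v ∧ w) = (x · v) ∧ w + v ∧ (x · w)`. -/
noncomputable instance : LieRingModule L (⋀[R]^2 M) where
  bracket x m := act R x m
  add_lie x y m := by
    have : act R (M := M) (x + y) = act R x + act R y := by
      ext v : 2
      simp only [LinearMap.compAlternatingMap_apply, LinearMap.add_apply, act_wedge, add_lie,
        wedge_add_left, wedge_add_right]
      abel
    exact LinearMap.congr_fun this m
  lie_add x m n := map_add _ m n
  leibniz_lie x y m := by
    have : act R (M := M) x ∘ₗ act R y = act R ⁅x, y⁆ + act R y ∘ₗ act R x := by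
      ext v : 2
      simp only [LinearMap.compAlternatingMap_apply, LinearMap.add_apply, LinearMap.comp_apply,
        act_wedge, map_add, lie_lie, Matrix.cons_val_zero, Matrix.cons_val_one, sub_eq_add_neg,
        wedge_add_left, wedge_add_right, wedge_neg_left, wedge_neg_right]
      abel
    exact LinearMap.congr_fun this m

noncomputable instance : LieModule R L (⋀[R]^2 M) where
  smul_lie c x m := by
    have : act R (M := M) (c • x) = c • act R x := by
      ext v : 2
      simp only [LinearMap.compAlternatingMap_apply, LinearMap.smul_apply, act_wedge, smul_lie,
        wedge_smul_left, wedge_smul_right, smul_add]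
    exact LinearMap.congr_fun this m
  lie_smul c x m := map_smul (act R x) c m

theorem lie_wedge (x : L) (v w : M) :
    ⁅x, exteriorPower.ιMulti R 2 ![v, w]⁆ =
      exteriorPower.ιMulti R 2 ![⁅x, v⁆, w] + exteriorPower.ιMulti R 2 ![v, ⁅x, w⁆] :=
  act_wedge R x ![v, w]

end LieExteriorSquare

/-! ### Socle series, uniserial modules and admissible sequences -/

section Modules

variable (K L M : Type*) [CommRing K] [LieRing L] [LieAlgebra K L]
  [AddCommGroup M] [Module K M] [LieRingModule L M] [LieModule K L M]

/-- The socle: the sum of all irreducible submodules. -/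
def lieSocle : LieSubmodule K L M :=
  sSup {N : LieSubmodule K L M | LieModule.IsIrreducible K L N}

/-- The socle series: `soc⁰ = 0`, and `socⁱ⁺¹` is the preimage in `M` of the socle of `M / socⁱ`;
so `socⁱ⁺¹ / socⁱ` is the socle of `M / socⁱ`. -/
def lieSocleSeries : ℕ → LieSubmodule K L M
  | 0 => ⊥
  | i + 1 => (lieSocle K L (M ⧸ lieSocleSeries i)).comap
      (LieSubmodule.Quotient.mk' (lieSocleSeries i))

/-- The `i`-th socle factor (counted from `0`), `socⁱ⁺¹(M) / socⁱ(M) = soc(M / socⁱ(M))`. -/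
abbrev LieSocleFactor (i : ℕ) : Type _ :=
  ↥(lieSocle K L (M ⧸ lieSocleSeries K L M i))

/-- A module is uniserial if its submodules form a chain. -/
def LieIsUniserial : Prop :=
  ∀ N₁ N₂ : LieSubmodule K L M, N₁ ≤ N₂ ∨ N₂ ≤ N₁

end Modules

/-- Two modules are disjoint if they have no irreducible constituent in common: no irreducible
submodule of the first is isomorphic to a submodule of the second. -/
def LieModulesDisjoint (K L M N : Type*) [CommRing K] [LieRing L] [LieAlgebra K L]
    [AddCommGroup M] [Module K M] [LieRingModule L M] [LieModule K L M]
    [AddCommGroup N] [Module K N] [LieRingModule L N] [LieModule K L N] : Prop :=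
  ¬ ∃ (P : LieSubmodule K L M) (Q : LieSubmodule K L N),
    LieModule.IsIrreducible K L P ∧ Nonempty (P ≃ₗ⁅K, L⁆ Q)

/-- `g = s ⋉ r` is a Levi decomposition, where `r` is the solvable radical of `g`. -/
structure IsLeviDecomposition (g : Type*) [LieRing g] [LieAlgebra ℂ g]
    (s : LieSubalgebra ℂ g) : Prop where
  isSemisimple : LieAlgebra.IsSemisimple ℂ s
  isCompl : IsCompl s.toSubmodule (LieAlgebra.radical ℂ g).toSubmodule

/-- The sequence `W 0, …, W n` of `s`-modules is admissible: there is a finite dimensional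
uniserial `g`-module `V` whose socle series is `0 = soc⁰ ⊂ ⋯ ⊂ socⁿ⁺¹ = V` and whose socle factors
are, in this order, isomorphic to `W 0, …, W n` as `s`-modules. -/
def IsAdmissibleSequence.{u, w} {g : Type u} [LieRing g] [LieAlgebra ℂ g]
    (s : LieSubalgebra ℂ g) {n : ℕ} (W : Fin (n + 1) → Type w) [∀ i, AddCommGroup (W i)] [∀ i, Module ℂ (W i)]
    [∀ i, LieRingModule s (W i)] [∀ i, LieModule ℂ s (W i)] : Prop :=
  ∃ (V : Type w) (_ : AddCommGroup V) (_ : Module ℂ V) (_ : LieRingModule g V)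
    (_ : LieModule ℂ g V),
    FiniteDimensional ℂ V ∧ LieIsUniserial ℂ g V ∧ lieSocleSeries ℂ g V (n + 1) = ⊤ ∧
      ∀ i : Fin (n + 1), Nonempty (LieSocleFactor ℂ g V i ≃ₗ⁅ℂ, s⁆ W i)

section Superdiagonal

attribute [local instance] LieRing.ofAssociativeRing

/-- For linear maps `h i : W (i + 1) → W i`, the endomorphism `∑ h i` of `V = W 0 ⊕ ⋯ ⊕ W n`, where
`h i` is extended by zero to the other summands. -/
noncomputable def superdiagonal {n : ℕ} {W : Fin (n + 1) → Type*} [∀ i, AddCommGroup (W i)]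
    [∀ i, Module ℂ (W i)] (h : ∀ i : Fin n, W i.succ →ₗ[ℂ] W i.castSucc) :
    Module.End ℂ (∀ i, W i) :=
  ∑ i : Fin n, LinearMap.single ℂ W i.castSucc ∘ₗ h i ∘ₗ LinearMap.proj i.succ

/-- The Lie subalgebra of `gl(V)`, `V = W 0 ⊕ ⋯ ⊕ W n`, generated by the sums `∑ f i r`
with `r` in the domain of the maps `f i : r ↦ Hom(W (i + 1), W i)`. -/
noncomputable def superdiagonalLieAlgebra {s r : Type*} [LieRing s] [LieAlgebra ℂ s]
    [AddCommGroup r] [Module ℂ r] [LieRingModule s r] [LieModule ℂ s r]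
    {n : ℕ} {W : Fin (n + 1) → Type*} [∀ i, AddCommGroup (W i)]
    [∀ i, Module ℂ (W i)] [∀ i, LieRingModule s (W i)] [∀ i, LieModule ℂ s (W i)]
    (f : ∀ i : Fin n, r →ₗ⁅ℂ, s⁆ (W i.succ →ₗ[ℂ] W i.castSucc)) :
    LieSubalgebra ℂ (Module.End ℂ (∀ i, W i)) :=
  LieSubalgebra.lieSpan ℂ (Module.End ℂ (∀ i, W i))
    (Set.range fun x : r => superdiagonal fun i => f i x)

end Superdiagonal

/-! ### Weyl's theorem on complete reducibility -/

section Weyl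

open Module LieModule

namespace LieAlgebra.IsKilling

variable {L : Type*} [LieRing L] [LieAlgebra ℂ L] [FiniteDimensional ℂ L] [IsKilling ℂ L]

/-! Write `r` for the radical, and count socle factors from `0`. By Weyl's theorem over the
semisimple `s`, proved here by Casimir elements and Whitehead's first lemma, modules are
non-disjoint exactly when there is a non-zero homomorphism between them; so non-disjointness from
`A* ⊗ B` means a non-zero `s`-map from `r` to `Hom(A, B)`.

Part (a): for uniserial `V`, choose an `s`-equivariant retraction `p` of `V / socⁱ` onto its socle.
The defect `p(xa) - x p(a)`, `x ∈ r`, vanishes for `a` in the socle, hence induces an `s`-map from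
`r` to the Hom space from factor `i + 1` to factor `i` (`exists_ne_zero_of_isUniserial`). If it were
zero, the kernel of `p` on `socⁱ⁺² / socⁱ` would be a `g`-submodule complementing `socⁱ⁺¹ / socⁱ`,
against uniseriality.

Part (b), necessity: if `g` is perfect, `r` acts on an irreducible module by scalars of trace zero,
so by zero. The maps above then describe the action of `r` on the graded module of the socle series,
and they inherit commutativity from `r`.

Sufficiency: let `s` act componentwise on `W 0 ⊕ ⋯ ⊕ W n` and `r` by the superdiagonal operators.
Equivariance of the `f i` and commutativity make this a `g`-module. Since each `f i` is non-zero and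
each `W i` irreducible, the only submodules are the partial sums
(`exists_eq_superdiagonalFiltration`), so the module is uniserial with the right factors.

The exterior square criterion: a commutator of two superdiagonal operators has blocks only from `W
(i + 2)` to `W i`. These are `s`-maps on `Λ² r`, so disjointness kills them. -/

theorem lie_top_top : ⁅(⊤ : LieIdeal ℂ L), (⊤ : LieIdeal ℂ L)⁆ = ⊤ := by
  have hc := LieIdeal.isCompl_killingCompl (⁅(⊤ : LieIdeal ℂ L), (⊤ : LieIdeal ℂ L)⁆)
  -- By invariance and non-degeneracy of the Killing form, an element orthogonal to all brackets is
  -- central, and the center is zero.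
  suffices h : LieIdeal.killingCompl ℂ L ⁅(⊤ : LieIdeal ℂ L), (⊤ : LieIdeal ℂ L)⁆ = ⊥ by
    rw [h] at hc
    exact eq_top_of_isCompl_bot hc
  rw [eq_bot_iff, ← center_eq_bot ℂ L]
  intro x hx
  rw [LieIdeal.mem_killingCompl] at hx
  rw [mem_maxTrivSubmodule]
  intro z
  have : killingForm ℂ L ⁅z, x⁆ = 0 := by
    ext y
    have := hx ⁅y, z⁆ (LieSubmodule.lie_mem_lie (LieSubmodule.mem_top y) (LieSubmodule.mem_top z))
    rw [traceForm_apply_lie_apply] at this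
    rwa [traceForm_comm]
  have h2 : ⁅z, x⁆ ∈ LinearMap.ker (killingForm ℂ L) := this
  rwa [ker_killingForm_eq_bot, Submodule.mem_bot] at h2

end LieAlgebra.IsKilling

namespace LieModule

variable {L : Type*} [LieRing L] [LieAlgebra ℂ L]
  {M : Type*} [AddCommGroup M] [Module ℂ M] [LieRingModule L M] [LieModule ℂ L M]

/-- The linear map `x ↦ ⁅x, m⁆`. -/
def orbitMap (m : M) : L →ₗ[ℂ] M where
  toFun x := ⁅x, m⁆
  map_add' x y := add_lie x y m
  map_smul' t x := smul_lie t x m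

omit [LieRingModule L M] [LieModule ℂ L M] in
-- The matrices of `ad y` on the two families are negative transposes of each other, so `y`
-- annihilates the tensor `∑ e i ⊗ d i`. A bilinear map therefore kills its derivative.
theorem sum_apply_lie_add_eq_zero {ι : Type*} [Fintype ι] {e d : ι → L} {y : L}
    (h : ∃ a : ι → ι → ℂ, (∀ i, ⁅y, e i⁆ = ∑ j, a i j • e j) ∧
      ∀ i, ⁅y, d i⁆ = - ∑ j, a j i • d j) (φ : L →ₗ[ℂ] L →ₗ[ℂ] M) :
    ∑ i, (φ ⁅y, e i⁆ (d i) + φ (e i) ⁅y, d i⁆) = 0 := by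
  obtain ⟨a, ha, hb⟩ := h
  simp only [ha, hb, map_sum, map_smul, map_neg, LinearMap.sum_apply, LinearMap.smul_apply,
    Finset.sum_add_distrib, Finset.sum_neg_distrib]
  rw [Finset.sum_comm, add_neg_cancel]

theorem casimir_lie {ι : Type*} [Fintype ι] {e d : ι → L} {y : L}
    (h : ∃ a : ι → ι → ℂ, (∀ i, ⁅y, e i⁆ = ∑ j, a i j • e j) ∧
      ∀ i, ⁅y, d i⁆ = - ∑ j, a j i • d j) (m : M) :
    ∑ i, ⁅e i, ⁅d i, ⁅y, m⁆⁆⁆ = ⁅y, ∑ i, ⁅e i, ⁅d i, m⁆⁆⁆ := by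
  have h1 := sum_apply_lie_add_eq_zero h (LinearMap.mk₂ ℂ (fun u v : L => ⁅u, ⁅v, m⁆⁆)
    (by simp) (by simp) (by simp) (by simp))
  simp only [LinearMap.mk₂_apply] at h1
  rw [lie_sum, eq_comm, ← sub_eq_zero, ← Finset.sum_sub_distrib, ← h1]
  refine Finset.sum_congr rfl fun i _ => ?_
  rw [leibniz_lie y (e i), leibniz_lie y (d i), lie_add]
  abel

/-- A Casimir element, attached to a pair of dual families, that acts invertibly exhibits every
`1`-cocycle as a coboundary. -/
theorem exists_eq_lie_of_casimir {ι : Type*} [Fintype ι] (e d : ι → L)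
    (h : ∀ y : L, ∃ a : ι → ι → ℂ, (∀ i, ⁅y, e i⁆ = ∑ j, a i j • e j) ∧
      ∀ i, ⁅y, d i⁆ = - ∑ j, a j i • d j)
    (C : M →ₗ[ℂ] M) (hC : ∀ m, C m = ∑ i, ⁅e i, ⁅d i, m⁆⁆) (hb : Function.Bijective C)
    (c : L →ₗ[ℂ] M) (hc : ∀ x y, c ⁅x, y⁆ = ⁅x, c y⁆ - ⁅y, c x⁆) :
    ∃ m, ∀ x, c x = ⁅x, m⁆ := by
  -- The same invariance, applied to `(u, v) ↦ ⁅u, c v⁆`: up to the invertible `C`, the vector `∑ ⁅e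
  -- i, c (d i)⁆` is the primitive of `c`.
  have key : ∀ y, ⁅y, ∑ i, ⁅e i, c (d i)⁆⁆ = C (c y) := by
    intro y
    have h1 := sum_apply_lie_add_eq_zero (h y) (LinearMap.mk₂ ℂ (fun u v : L => ⁅u, c v⁆)
      (by simp) (by simp) (by simp) (by simp))
    simp only [LinearMap.mk₂_apply] at h1
    rw [hC, lie_sum, ← sub_eq_zero, ← Finset.sum_sub_distrib, ← h1]
    refine Finset.sum_congr rfl fun i _ => ?_
    rw [leibniz_lie y (e i), hc y (d i), lie_sub]
    abel
  obtain ⟨m, hm⟩ := hb.2 (∑ i, ⁅e i, c (d i)⁆)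
  refine ⟨m, fun x => hb.1 ?_⟩
  rw [hC ⁅x, m⁆, casimir_lie (h x), ← hC, hm, key]

variable [FiniteDimensional ℂ L] [LieAlgebra.IsKilling ℂ L] [FiniteDimensional ℂ M]

omit [LieModule ℂ L M] [FiniteDimensional ℂ M] in
theorem eq_zero_of_cocycle_of_isTrivial [IsTrivial L M] (c : L →ₗ[ℂ] M)
    (hc : ∀ x y, c ⁅x, y⁆ = ⁅x, c y⁆ - ⁅y, c x⁆) : c = 0 := by
  have h : (⊤ : LieIdeal ℂ L).toSubmodule ≤ LinearMap.ker c := by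
    rw [← LieAlgebra.IsKilling.lie_top_top, LieSubmodule.lieIdeal_oper_eq_linear_span',
      Submodule.span_le]
    rintro _ ⟨x, -, y, -, rfl⟩
    simp [hc, trivial_lie_zero]
  ext x
  exact h (LieSubmodule.mem_top x)

/-- Cartan's criterion makes the derived algebra, which is all of `L`, act nilpotently. Engel's
theorem gives non-zero invariants, and they fill an irreducible module. -/
theorem isTrivial_of_traceForm_eq_zero [IsIrreducible ℂ L M] (h : traceForm ℂ L M = 0) :
    IsTrivial L M := by
  have h1 := isNilpotent_derivedSeries_of_traceForm_eq_zero h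
  have h2 : LieAlgebra.derivedSeries ℂ L 1 = ⊤ := LieAlgebra.IsKilling.lie_top_top
  have h3 : IsNilpotent L M := by
    rw [isNilpotent_iff_forall' (R := ℂ)] at h1 ⊢
    intro x
    exact h1 ⟨x, by rw [h2]; exact LieSubmodule.mem_top x⟩
  have : Nontrivial M := nontrivial_of_isIrreducible ℂ L M
  have h4 := nontrivial_max_triv_of_isNilpotent ℂ L M
  rw [isTrivial_iff_max_triv_eq_top ℂ]
  exact LieSubmodule.eq_top_of_isIrreducible ℂ L M _

/-- The trace form `B` may be degenerate, so the Casimir element is built on the ideal `I`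
complementary to its radical `J`. The Casimir operator is non-zero, and Schur's lemma makes it
bijective. -/
theorem exists_eq_lie_of_isIrreducible [IsIrreducible ℂ L M] (c : L →ₗ[ℂ] M)
    (hc : ∀ x y, c ⁅x, y⁆ = ⁅x, c y⁆ - ⁅y, c x⁆) : ∃ m, ∀ x, c x = ⁅x, m⁆ := by
  by_cases hB : traceForm ℂ L M = 0
  · have := isTrivial_of_traceForm_eq_zero hB
    exact ⟨0, fun x => by simp [eq_zero_of_cocycle_of_isTrivial c hc]⟩
  set B := traceForm ℂ L M with hBdef
  have hinv : B.lieInvariant L := traceForm_lieInvariant ℂ L M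
  let J : LieIdeal ℂ L := LieAlgebra.InvariantForm.orthogonal B hinv ⊤
  have hJ : ∀ x, x ∈ J ↔ ∀ y, B y x = 0 := fun x => by
    simp [J, LieAlgebra.InvariantForm.mem_orthogonal]
  let I : LieIdeal ℂ L := LieIdeal.killingCompl ℂ L J
  have hIJ : IsCompl J I := LieIdeal.isCompl_killingCompl J
  have hdec : ∀ x : L, ∃ u ∈ J, ∃ v ∈ I, u + v = x := fun x =>
    (LieSubmodule.mem_sup J I x).mp (by rw [hIJ.sup_eq_top]; exact LieSubmodule.mem_top x)
  let B' : LinearMap.BilinForm ℂ I := B.restrict I.toSubmodule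
  have hB' : ∀ x y : I, B' x y = B x y := fun _ _ => rfl
  have hsymm : B'.IsSymm := ⟨fun x y => traceForm_comm ℂ L M _ _⟩
  have hnd : B'.Nondegenerate := by
    refine hsymm.isRefl.nondegenerate_iff_separatingLeft.mpr fun x hx => ?_
    have : (x : L) ∈ J ⊓ I := by
      refine ⟨(hJ _).mpr fun y => ?_, x.2⟩
      obtain ⟨u, hu, v, hv, rfl⟩ := hdec y
      rw [map_add, LinearMap.add_apply, hBdef, traceForm_comm ℂ L M u, (hJ u).mp hu,
        traceForm_comm ℂ L M v, zero_add]
      exact hx ⟨v, hv⟩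
    rw [hIJ.inf_eq_bot] at this
    exact Subtype.ext this
  let b := Module.finBasis ℂ I
  let d := B'.dualBasis hnd b
  have hbd : ∀ i j, B' (b i) (d j) = if i = j then 1 else 0 :=
    LinearMap.BilinForm.apply_dualBasis_right hnd hsymm b
  have hbx : ∀ x : I, x = ∑ j, B' x (d j) • b j := by
    intro x
    conv_lhs => rw [← b.sum_repr x]
    refine Finset.sum_congr rfl fun j _ => ?_
    rw [← LinearMap.BilinForm.dualBasis_repr_apply hnd,
      LinearMap.BilinForm.dualBasis_dualBasis hnd hsymm]
  have hdx : ∀ x : I, x = ∑ j, B' (b j) x • d j := by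
    intro x
    conv_lhs => rw [← d.sum_repr x]
    refine Finset.sum_congr rfl fun j _ => ?_
    rw [LinearMap.BilinForm.dualBasis_repr_apply, hsymm.eq]
  let C : M →ₗ[ℂ] M := ∑ i, toEnd ℂ L M (b i : L) ∘ₗ toEnd ℂ L M (d i : L)
  have hCm : ∀ m, C m = ∑ i, ⁅(b i : L), ⁅(d i : L), m⁆⁆ := fun m => by simp [C]
  have hfam : ∀ y : L, ∃ a : Fin (finrank ℂ I) → Fin (finrank ℂ I) → ℂ,
      (∀ i, ⁅y, (b i : L)⁆ = ∑ j, a i j • (b j : L)) ∧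
      ∀ i, ⁅y, (d i : L)⁆ = - ∑ j, a j i • (d j : L) := by
    intro y
    refine ⟨fun i j => B ⁅y, (b i : L)⁆ (d j), fun i => ?_, fun i => ?_⟩
    · have := congrArg (Subtype.val) (hbx ⁅y, b i⁆)
      simpa [hB'] using this
    · have := congrArg (Subtype.val) (hdx ⁅y, d i⁆)
      simp only [hB', LieSubmodule.coe_bracket, AddSubmonoidClass.coe_finsetSum,
        SetLike.val_smul] at this
      rw [this, ← Finset.sum_neg_distrib]
      refine Finset.sum_congr rfl fun j _ => ?_
      simp only [hinv y, neg_smul, neg_neg]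
  have hCy : ∀ (y : L) m, C ⁅y, m⁆ = ⁅y, C m⁆ := by
    intro y m
    rw [hCm, hCm, casimir_lie (hfam y)]
  have hCne : C ≠ 0 := by
    intro h0
    -- Each summand has trace `B (b i) (d i) = 1`. If `dim I = 0`, then `J` is everything and `B =
    -- 0`.
    have htr : LinearMap.trace ℂ M C = finrank ℂ I := by
      have : ∀ i, LinearMap.trace ℂ M (toEnd ℂ L M (b i : L) ∘ₗ toEnd ℂ L M (d i : L)) = 1 := by
        intro i
        simpa [hB', hBdef, traceForm_apply_apply] using hbd i i
      simp [C, this]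
    rw [h0, map_zero, eq_comm, Nat.cast_eq_zero, finrank_zero_iff] at htr
    apply hB
    ext x y
    obtain ⟨u, hu, v, hv, rfl⟩ := hdec y
    have hv0 : v = 0 := congrArg Subtype.val (Subsingleton.elim (⟨v, hv⟩ : I) 0)
    rw [hv0, add_zero, (hJ u).mp hu]
    rfl
  let K : LieSubmodule ℂ L M := { LinearMap.ker C with
    lie_mem := fun {x m} hm => by
      have hm : C m = 0 := hm
      change C ⁅x, m⁆ = 0
      rw [hCy, hm, lie_zero] }
  have hK : K = ⊥ := by
    refine (IsSimpleOrder.eq_bot_or_eq_top K).resolve_right fun h => hCne ?_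
    ext m
    have : m ∈ K := h ▸ LieSubmodule.mem_top m
    exact this
  have hinj : Function.Injective C := by
    rw [← LinearMap.ker_eq_bot]
    exact (congrArg LieSubmodule.toSubmodule hK : _)
  refine exists_eq_lie_of_casimir (fun i => (b i : L)) (fun i => (d i : L)) hfam C hCm ?_ c hc
  exact ⟨hinj, LinearMap.injective_iff_surjective.mp hinj⟩

omit [FiniteDimensional ℂ M] in
-- Induction on dimension: solve in `M / N`, lift the solution, subtract its coboundary, and solve
-- for the remaining cocycle, which takes values in `N`.
theorem exists_eq_lie_of_finrank (n : ℕ) : ∀ (M : Type*) [AddCommGroup M] [Module ℂ M]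
    [LieRingModule L M] [LieModule ℂ L M] [FiniteDimensional ℂ M], finrank ℂ M = n →
    ∀ c : L →ₗ[ℂ] M, (∀ x y, c ⁅x, y⁆ = ⁅x, c y⁆ - ⁅y, c x⁆) → ∃ m, ∀ x, c x = ⁅x, m⁆ := by
  induction n using Nat.strong_induction_on with
  | _ n ih =>
  intro M _ _ _ _ _ hn c hc
  rcases subsingleton_or_nontrivial M with hM | hM
  · exact ⟨0, fun x => Subsingleton.elim _ _⟩
  by_cases hirr : ∀ N : LieSubmodule ℂ L M, N ≠ ⊥ → N = ⊤
  · have := IsIrreducible.mk hirr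
    exact exists_eq_lie_of_isIrreducible c hc
  push Not at hirr
  obtain ⟨N, hN0, hN1⟩ := hirr
  have hN1' : N.toSubmodule < ⊤ := lt_top_iff_ne_top.mpr (by simpa using hN1)
  have hN0' : ⊥ < N.toSubmodule := bot_lt_iff_ne_bot.mpr (by simpa using hN0)
  have hd := Submodule.finrank_quotient_add_finrank N.toSubmodule
  have hd1 := Submodule.finrank_lt hN1'.ne
  have hd0 : 0 < finrank ℂ N.toSubmodule := by
    have := Submodule.finrank_lt_finrank_of_lt hN0'
    omega
  have hfq : FiniteDimensional ℂ (M ⧸ N) :=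
    inferInstanceAs (FiniteDimensional ℂ (M ⧸ N.toSubmodule))
  obtain ⟨q, hq⟩ := ih (finrank ℂ (M ⧸ N.toSubmodule)) (by omega) (M ⧸ N) rfl
    ((LieSubmodule.Quotient.mk' N : M →ₗ[ℂ] M ⧸ N) ∘ₗ c) (fun x y => by
      simp only [LinearMap.comp_apply, hc, map_sub, LieModuleHom.coe_toLinearMap,
        LieModuleHom.map_lie])
  obtain ⟨m, rfl⟩ := LieSubmodule.Quotient.surjective_mk' N q
  have hcN : ∀ x, c x - ⁅x, m⁆ ∈ N := fun x => by
    rw [← LieSubmodule.Quotient.mk_eq_zero, map_sub, sub_eq_zero, LieModuleHom.map_lie]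
    exact hq x
  obtain ⟨k, hk⟩ := ih (finrank ℂ N.toSubmodule) (by omega) N rfl
    ((c - orbitMap m).codRestrict N.toSubmodule hcN)
    (fun x y => by
      apply Subtype.ext
      change c ⁅x, y⁆ - ⁅⁅x, y⁆, m⁆ = ⁅x, c y - ⁅y, m⁆⁆ - ⁅y, c x - ⁅x, m⁆⁆
      rw [hc, lie_lie, lie_sub, lie_sub]
      abel)
  refine ⟨m + k, fun x => ?_⟩
  have : c x - ⁅x, m⁆ = ⁅x, (k : M)⁆ := congrArg Subtype.val (hk x)
  rw [lie_add, ← this, add_sub_cancel]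

/-- **Whitehead's first lemma**: every `1`-cocycle of a semisimple Lie algebra with values in a
finite-dimensional module is a coboundary. -/
theorem exists_eq_lie_of_cocycle (c : L →ₗ[ℂ] M)
    (hc : ∀ x y, c ⁅x, y⁆ = ⁅x, c y⁆ - ⁅y, c x⁆) : ∃ m, ∀ x, c x = ⁅x, m⁆ :=
  exists_eq_lie_of_finrank _ M rfl c hc

/-- **Weyl's theorem**: an injective homomorphism of finite-dimensional modules over a semisimple
Lie algebra has a retraction. -/
theorem exists_leftInverse_of_injective {N : Type*} [AddCommGroup N] [Module ℂ N]
    [LieRingModule L N] [LieModule ℂ L N] [FiniteDimensional ℂ N] (j : N →ₗ⁅ℂ, L⁆ M)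
    (hj : Function.Injective j) : ∃ p : M →ₗ⁅ℂ, L⁆ N, ∀ n, p (j n) = n := by
  obtain ⟨p, hp⟩ := LinearMap.exists_leftInverse_of_injective (j : N →ₗ[ℂ] M)
    (LinearMap.ker_eq_bot.mpr hj)
  replace hp : ∀ n, p (j n) = n := fun n => LinearMap.congr_fun hp n
  -- Linear retractions of `j` form an affine space over `A`. The cocycle `x ↦ ⁅x, p⁆` takes values
  -- in `A`; if it is the coboundary of `q`, then `p - q` is an equivariant retraction.
  let A : LieSubmodule ℂ L (M →ₗ[ℂ] N) :=
    { carrier := {q | ∀ n, q (j n) = 0}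
      add_mem' := fun {a b} ha hb n => by simp [ha n, hb n]
      zero_mem' := fun n => rfl
      smul_mem' := fun t a ha n => by simp [ha n]
      lie_mem := fun {x q} hq n => by
        have hq : ∀ n, q (j n) = 0 := hq
        rw [LieHom.lie_apply, ← LieModuleHom.map_lie, hq, hq, lie_zero, sub_zero] }
  have hpA : ∀ x : L, ⁅x, p⁆ ∈ A := fun x n => by
    rw [LieHom.lie_apply, ← LieModuleHom.map_lie, hp, hp, sub_self]
  obtain ⟨q, hq⟩ := exists_eq_lie_of_cocycle (M := A)
    ((orbitMap p).codRestrict A.toSubmodule hpA)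
    (fun x y => by
      apply Subtype.ext
      change ⁅⁅x, y⁆, p⁆ = ⁅x, ⁅y, p⁆⁆ - ⁅y, ⁅x, p⁆⁆
      rw [lie_lie])
  have hq' : ∀ x : L, ⁅x, p⁆ = ⁅x, (q : M →ₗ[ℂ] N)⁆ := fun x => congrArg Subtype.val (hq x)
  refine ⟨{ p - (q : M →ₗ[ℂ] N) with map_lie' := fun {x m} => ?_ }, fun n => ?_⟩
  · have := LinearMap.congr_fun (hq' x) m
    rw [LieHom.lie_apply, LieHom.lie_apply] at this
    change p ⁅x, m⁆ - (q : M →ₗ[ℂ] N) ⁅x, m⁆ = ⁅x, p m - (q : M →ₗ[ℂ] N) m⁆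
    rw [lie_sub]
    rw [sub_eq_sub_iff_sub_eq_sub] at this
    exact this.symm
  · change p (j n) - (q : M →ₗ[ℂ] N) (j n) = n
    rw [hp, q.2 n, sub_zero]

end LieModule
end Weyl

/-! ### Homomorphisms of Lie modules -/

section Homs

open Module LieModule

variable {L : Type*} [LieRing L] [LieAlgebra ℂ L]
  {A B C r : Type*} [AddCommGroup A] [Module ℂ A] [LieRingModule L A] [LieModule ℂ L A]
  [AddCommGroup B] [Module ℂ B] [LieRingModule L B] [LieModule ℂ L B]
  [AddCommGroup C] [Module ℂ C] [LieRingModule L C] [LieModule ℂ L C]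
  [AddCommGroup r] [Module ℂ r] [LieRingModule L r] [LieModule ℂ L r]

/-- A bijective homomorphism of Lie modules is an equivalence. -/
noncomputable def LieModuleHom.equivOfBijective (f : A →ₗ⁅ℂ, L⁆ B) (hf : Function.Bijective f) :
    A ≃ₗ⁅ℂ, L⁆ B :=
  { LinearEquiv.ofBijective (f : A →ₗ[ℂ] B) hf with
    map_lie' := fun {x m} => f.map_lie x m }

omit [LieAlgebra ℂ L] [LieModule ℂ L A] [LieModule ℂ L B] in
theorem LieModuleHom.nonempty_equiv_range (f : A →ₗ⁅ℂ, L⁆ B) (hf : Function.Injective f) :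
    Nonempty (A ≃ₗ⁅ℂ, L⁆ f.range) :=
  ⟨LieModuleHom.equivOfBijective (f.codRestrict f.range fun m => ⟨m, rfl⟩)
    ⟨fun a b h => hf (congrArg Subtype.val h), by rintro ⟨_, a, rfl⟩; exact ⟨a, rfl⟩⟩⟩

omit [LieAlgebra ℂ L] [LieModule ℂ L A] in
theorem LieSubmodule.isIrreducible_iff_isAtom (P : LieSubmodule ℂ L A) :
    IsIrreducible ℂ L P ↔ IsAtom P := by
  constructor
  · intro h
    have hP : Nontrivial P := nontrivial_of_isIrreducible ℂ L P
    refine ⟨(LieSubmodule.nontrivial_iff_ne_bot ℂ L A).mp hP, fun Q hQ => ?_⟩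
    rcases IsSimpleOrder.eq_bot_or_eq_top (Q.comap P.incl) with h1 | h1
    · rw [LieSubmodule.eq_bot_iff] at h1 ⊢
      intro m hm
      exact congrArg Subtype.val (h1 ⟨m, hQ.le hm⟩ hm)
    · refine absurd (fun m hm => ?_) (not_le_of_gt hQ)
      have : (⟨m, hm⟩ : P) ∈ Q.comap P.incl := h1 ▸ LieSubmodule.mem_top _
      exact this
  · intro h
    have hP : Nontrivial P := (LieSubmodule.nontrivial_iff_ne_bot ℂ L A).mpr h.1
    refine IsIrreducible.mk fun Q hQ => ?_
    have hle : Q.map P.incl ≤ P := by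
      intro m hm
      obtain ⟨q, -, rfl⟩ := (LieSubmodule.mem_map m).mp hm
      exact q.2
    rcases h.le_iff.mp hle with h1 | h1
    · refine absurd ((LieSubmodule.eq_bot_iff Q).mpr fun q hq => ?_) hQ
      have := LieSubmodule.mem_map_of_mem (f := P.incl) hq
      rw [h1, LieSubmodule.mem_bot] at this
      exact Subtype.ext this
    · rw [eq_top_iff]
      intro q _
      have : (q : A) ∈ Q.map P.incl := by rw [h1]; exact q.2
      obtain ⟨q', hq', h2⟩ := (LieSubmodule.mem_map _).mp this
      rwa [← Subtype.ext (show (q' : A) = q from h2)]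

omit [LieAlgebra ℂ L] [LieModule ℂ L A] [LieModule ℂ L B] in
theorem LieModuleHom.injective_of_ne_zero [IsIrreducible ℂ L A] (f : A →ₗ⁅ℂ, L⁆ B) (hf : f ≠ 0) :
    Function.Injective f := by
  rw [← LieModuleHom.ker_eq_bot]
  refine (IsSimpleOrder.eq_bot_or_eq_top f.ker).resolve_right fun h => hf ?_
  ext a
  have : a ∈ f.ker := h ▸ LieSubmodule.mem_top a
  exact LieModuleHom.mem_ker.mp this

omit [LieModule ℂ L r] in
-- The linear section of `α` is not equivariant, but `h x a` depends only on `α a`, so the choice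
-- does not matter.
theorem LieModuleHom.exists_factor (α : A →ₗ⁅ℂ, L⁆ B) (hα : Function.Surjective α)
    (h : r →ₗ⁅ℂ, L⁆ (A →ₗ[ℂ] C)) (h0 : ∀ x a, α a = 0 → h x a = 0) :
    ∃ f : r →ₗ⁅ℂ, L⁆ (B →ₗ[ℂ] C), ∀ x a, f x (α a) = h x a := by
  obtain ⟨σ, hσ⟩ := LinearMap.exists_rightInverse_of_surjective (α : A →ₗ[ℂ] B)
    (LinearMap.range_eq_top.mpr hα)
  replace hσ : ∀ b, α (σ b) = b := fun b => LinearMap.congr_fun hσ b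
  have key : ∀ x a a', α a = α a' → h x a = h x a' := fun x a a' haa => by
    rw [← sub_eq_zero, ← map_sub]
    exact h0 x _ (by rw [map_sub, haa, sub_self])
  refine ⟨{ (LinearMap.lcomp ℂ C σ) ∘ₗ (h : r →ₗ[ℂ] (A →ₗ[ℂ] C)) with
    map_lie' := fun {y x} => ?_ }, fun x a => key x _ _ (hσ _)⟩
  ext b
  change h ⁅y, x⁆ (σ b) = ⁅y, h x (σ b)⁆ - h x (σ ⁅y, b⁆)
  rw [LieModuleHom.map_lie, LieHom.lie_apply, key x (σ ⁅y, b⁆) ⁅y, σ b⁆]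
  rw [LieModuleHom.map_lie, hσ, hσ]

omit [LieAlgebra ℂ L] [LieModule ℂ L A] [LieModule ℂ L B] [LieModule ℂ L C] in
theorem LieModuleHom.nonempty_equiv_of_ker_eq (α : A →ₗ⁅ℂ, L⁆ B) (hα : Function.Surjective α)
    (β : A →ₗ⁅ℂ, L⁆ C) (hβ : Function.Surjective β) (h : ∀ a, α a = 0 ↔ β a = 0) :
    Nonempty (B ≃ₗ⁅ℂ, L⁆ C) := by
  obtain ⟨σ, hσ⟩ := LinearMap.exists_rightInverse_of_surjective (α : A →ₗ[ℂ] B)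
    (LinearMap.range_eq_top.mpr hα)
  replace hσ : ∀ b, α (σ b) = b := fun b => LinearMap.congr_fun hσ b
  have key : ∀ a a', α a = α a' ↔ β a = β a' := fun a a' => by
    rw [← sub_eq_zero, ← map_sub, h, map_sub, sub_eq_zero]
  have hf : ∀ a, β (σ (α a)) = β a := fun a => (key _ _).mp (hσ _)
  refine ⟨LieModuleHom.equivOfBijective { (β : A →ₗ[ℂ] C) ∘ₗ σ with
    map_lie' := fun {y b} => ?_ } ⟨fun b b' hb => ?_, fun c => ?_⟩⟩
  · change β (σ ⁅y, b⁆) = ⁅y, β (σ b)⁆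
    rw [← LieModuleHom.map_lie, ← key, LieModuleHom.map_lie, hσ, hσ]
  · have : α (σ b) = α (σ b') := (key _ _).mpr hb
    rwa [hσ, hσ] at this
  · obtain ⟨a, rfl⟩ := hβ c
    exact ⟨α a, hf a⟩

/-- The isomorphism `A* ⊗ B ≃ Hom(A, B)` of Lie modules. -/
noncomputable def LieModule.dualTensorEquiv [FiniteDimensional ℂ A] :
    (Module.Dual ℂ A ⊗[ℂ] B) ≃ₗ⁅ℂ, L⁆ (A →ₗ[ℂ] B) :=
  { dualTensorHomEquiv ℂ A B with
    map_lie' := fun {x t} => by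
      change dualTensorHom ℂ A B ⁅x, t⁆ = ⁅x, dualTensorHom ℂ A B t⁆
      induction t using TensorProduct.induction_on with
      | zero => simp
      | add t u ht hu => rw [lie_add, map_add, map_add, lie_add, ht, hu]
      | tmul φ b =>
        ext a
        rw [TensorProduct.LieModule.lie_tmul_right, map_add, LieHom.lie_apply]
        simp only [LinearMap.add_apply, dualTensorHom_apply, Module.Dual.lie_apply, lie_smul,
          neg_smul]
        abel }

variable [FiniteDimensional ℂ L] [LieAlgebra.IsKilling ℂ L] [FiniteDimensional ℂ A]

/-- Both directions rest on Weyl's theorem: a common constituent is a direct summand of `A`, and for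
`f ≠ 0` any irreducible submodule of a complement of `f.ker` embeds in `B`. -/
theorem not_lieModulesDisjoint_iff :
    ¬ LieModulesDisjoint ℂ L A B ↔ ∃ f : A →ₗ⁅ℂ, L⁆ B, f ≠ 0 := by
  rw [LieModulesDisjoint, not_not]
  constructor
  · rintro ⟨P, Q, hP, ⟨e⟩⟩
    obtain ⟨p, hp⟩ := exists_leftInverse_of_injective P.incl P.injective_incl
    have hPn : Nontrivial P := nontrivial_of_isIrreducible ℂ L P
    obtain ⟨a, ha⟩ := exists_ne (0 : P)
    refine ⟨Q.incl.comp ((e : P →ₗ⁅ℂ, L⁆ Q).comp p), fun h => ha ?_⟩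
    have h1 : ((e (p (P.incl a)) : Q) : B) = 0 := LieModuleHom.congr_fun h (P.incl a)
    rw [hp] at h1
    have h2 : e a = e 0 := by
      rw [Subtype.ext_iff, h1]
      exact (congrArg Subtype.val (LinearEquiv.map_zero e.toLinearEquiv)).symm
    exact e.injective h2
  · rintro ⟨f, hf⟩
    obtain ⟨p, hp⟩ := exists_leftInverse_of_injective f.ker.incl f.ker.injective_incl
    have hp0 : p.ker ≠ ⊥ := by
      intro h
      rw [LieModuleHom.ker_eq_bot] at h
      refine hf (LieModuleHom.ext fun a => ?_)
      have : a = f.ker.incl (p a) := h (hp _).symm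
      rw [this]
      exact LieModuleHom.mem_ker.mp (p a).2
    obtain ⟨P, hP, hPle⟩ := (eq_bot_or_exists_atom_le p.ker).resolve_left hp0
    have hirr := (LieSubmodule.isIrreducible_iff_isAtom P).mpr hP
    have hinj : Function.Injective (f.comp P.incl) := by
      rw [← LieModuleHom.ker_eq_bot, LieSubmodule.eq_bot_iff]
      intro a ha
      have h1 : (a : A) ∈ f.ker := ha
      have h2 : p (a : A) = 0 := LieModuleHom.mem_ker.mp (hPle a.2)
      have h3 := hp ⟨a, h1⟩
      rw [show f.ker.incl ⟨(a : A), h1⟩ = a from rfl, h2] at h3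
      exact Subtype.ext (congrArg Subtype.val h3).symm
    exact ⟨P, _, hirr, LieModuleHom.nonempty_equiv_range _ hinj⟩

theorem not_lieModulesDisjoint_dual_tensor_iff [FiniteDimensional ℂ B] :
    ¬ LieModulesDisjoint ℂ L A (Module.Dual ℂ B ⊗[ℂ] C) ↔
      ∃ f : A →ₗ⁅ℂ, L⁆ (B →ₗ[ℂ] C), f ≠ 0 := by
  rw [not_lieModulesDisjoint_iff]
  let E : (Module.Dual ℂ B ⊗[ℂ] C) ≃ₗ⁅ℂ, L⁆ (B →ₗ[ℂ] C) := LieModule.dualTensorEquiv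
  constructor
  · rintro ⟨f, hf⟩
    refine ⟨(E : _ →ₗ⁅ℂ, L⁆ _).comp f, fun h => hf (LieModuleHom.ext fun a => ?_)⟩
    exact (LinearEquiv.map_eq_zero_iff E.toLinearEquiv).mp (LieModuleHom.congr_fun h a)
  · rintro ⟨f, hf⟩
    refine ⟨(E.symm : _ →ₗ⁅ℂ, L⁆ _).comp f, fun h => hf (LieModuleHom.ext fun a => ?_)⟩
    exact (LinearEquiv.map_eq_zero_iff E.symm.toLinearEquiv).mp (LieModuleHom.congr_fun h a)

end Homs

/-! ### The socle series -/

section Socle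

open LieModule

variable {g : Type*} [LieRing g] [LieAlgebra ℂ g]

namespace IsLeviDecomposition

variable {s : LieSubalgebra ℂ g} (hLevi : IsLeviDecomposition g s)

include hLevi

theorem exists_add_eq (z : g) : ∃ (y : s) (x : LieAlgebra.radical ℂ g), (y : g) + x = z := by
  have hz : z ∈ s.toSubmodule ⊔ (LieAlgebra.radical ℂ g).toSubmodule := by
    rw [hLevi.isCompl.sup_eq_top]
    exact Submodule.mem_top
  obtain ⟨y, hy, x, hx, rfl⟩ := Submodule.mem_sup.mp hz
  exact ⟨⟨y, hy⟩, ⟨x, hx⟩, rfl⟩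

theorem isKilling [FiniteDimensional ℂ g] : LieAlgebra.IsKilling ℂ s := by
  have := hLevi.isSemisimple
  infer_instance

end IsLeviDecomposition

/-! ### Failure of `s`-homomorphisms to be `g`-equivariant -/

section Defect

variable (s : LieSubalgebra ℂ g) (I : LieIdeal ℂ g)
  {A U S : Type*} [AddCommGroup A] [Module ℂ A] [LieRingModule g A] [LieModule ℂ g A]
  [AddCommGroup U] [Module ℂ U] [LieRingModule g U] [LieModule ℂ g U]
  [AddCommGroup S] [Module ℂ S] [LieRingModule g S] [LieModule ℂ g S]

/-- The failure of an `s`-homomorphism `p` to be equivariant with respect to an ideal,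
precomposed with a homomorphism `q`. -/
def LieModuleHom.defect (q : A →ₗ⁅ℂ, g⁆ U) (p : U →ₗ⁅ℂ, s⁆ S) : I →ₗ⁅ℂ, s⁆ (A →ₗ[ℂ] S) where
  toFun x :=
    { toFun a := p ⁅(x : g), q a⁆ - ⁅(x : g), p (q a)⁆
      map_add' a b := by simp only [map_add, lie_add]; abel
      map_smul' t a := by simp [smul_sub] }
  map_add' x y := by
    ext a
    simp only [LieSubmodule.coe_add, add_lie, map_add, LinearMap.coe_mk, AddHom.coe_mk,
      LinearMap.add_apply]
    abel
  map_smul' t x := by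
    ext a
    simp [smul_sub]
  map_lie' {y x} := by
    ext a
    have hp : ∀ u, p ⁅(y : g), u⁆ = ⁅(y : g), p u⁆ := fun u => p.map_lie y u
    rw [LieHom.lie_apply]
    change p ⁅⁅(y : g), (x : g)⁆, q a⁆ - ⁅⁅(y : g), (x : g)⁆, p (q a)⁆ =
      ⁅(y : g), p ⁅(x : g), q a⁆ - ⁅(x : g), p (q a)⁆⁆ -
        (p ⁅(x : g), q ⁅(y : g), a⁆⁆ - ⁅(x : g), p (q ⁅(y : g), a⁆)⁆)
    simp only [lie_lie, map_sub, lie_sub, LieModuleHom.map_lie, hp]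
    abel

/-- Postcomposition with a homomorphism of Lie modules. -/
def LieModuleHom.postcomp {L A B C : Type*} [LieRing L] [LieAlgebra ℂ L]
    [AddCommGroup A] [Module ℂ A] [LieRingModule L A] [LieModule ℂ L A]
    [AddCommGroup B] [Module ℂ B] [LieRingModule L B] [LieModule ℂ L B]
    [AddCommGroup C] [Module ℂ C] [LieRingModule L C] [LieModule ℂ L C] (e : B →ₗ⁅ℂ, L⁆ C) :
    (A →ₗ[ℂ] B) →ₗ⁅ℂ, L⁆ (A →ₗ[ℂ] C) :=
  { LinearMap.compRight ℂ (e : B →ₗ[ℂ] C) with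
    map_lie' := fun {y f} => by
      ext a
      change e (⁅y, f⁆ a) = ⁅y, (e : B →ₗ[ℂ] C) ∘ₗ f⁆ a
      rw [LieHom.lie_apply, LieHom.lie_apply, map_sub, LieModuleHom.map_lie]
      rfl }

variable {s}

omit [LieModule ℂ g U] [LieModule ℂ g S] in
/-- In a uniserial module, an `s`-homomorphism that restricts to a surjection of a proper
`g`-submodule cannot be equivariant with respect to the radical. -/
theorem LieIsUniserial.exists_defect_ne_zero (hLevi : IsLeviDecomposition g s)
    (hU : LieIsUniserial ℂ g U) (p : U →ₗ⁅ℂ, s⁆ S) (N₁ N₂ : LieSubmodule ℂ g U)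
    (hp : ∀ c : S, ∃ b ∈ N₁, p b = c) [Nontrivial S] (hle : N₁ ≤ N₂) (hlt : ¬ N₂ ≤ N₁) :
    ∃ x : LieAlgebra.radical ℂ g, ∃ a ∈ N₂, p ⁅(x : g), a⁆ - ⁅(x : g), p a⁆ ≠ 0 := by
  by_contra! hcon
  let K : LieSubmodule ℂ g U :=
    { N₂.toSubmodule ⊓ LinearMap.ker (p : U →ₗ[ℂ] S) with
      lie_mem := fun {z a} ha => by
        obtain ⟨ha1, ha2⟩ := ha
        have ha2 : p a = 0 := ha2
        refine ⟨N₂.lie_mem ha1, ?_⟩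
        change p ⁅z, a⁆ = 0
        obtain ⟨y, x, rfl⟩ := hLevi.exists_add_eq z
        have h1 : p ⁅(y : g), a⁆ = ⁅(y : g), p a⁆ := p.map_lie y a
        rw [add_lie, map_add, h1, sub_eq_zero.mp (hcon x a ha1), ha2, lie_zero, lie_zero,
          add_zero] }
  have hK : ∀ a, a ∈ K ↔ a ∈ N₂ ∧ p a = 0 := fun a => Iff.rfl
  -- As `p` maps `N₁` onto `S`, the sum of `K` and `N₁` is `N₂`, so `K ≤ N₁` forces `N₂ ≤ N₁`. On
  -- the other hand `N₁ ≤ K` makes `p` vanish on `N₁`.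
  rcases hU K N₁ with h | h
  · refine hlt fun a ha => ?_
    obtain ⟨b, hb, hpb⟩ := hp (p a)
    have := h ((hK (a - b)).mpr ⟨sub_mem ha (hle hb), by rw [map_sub, hpb, sub_self]⟩)
    simpa using add_mem this hb
  · obtain ⟨c, hc⟩ := exists_ne (0 : S)
    obtain ⟨b, hb, rfl⟩ := hp c
    exact hc ((hK b).mp (h hb)).2

end Defect

variable (V : Type*) [AddCommGroup V] [Module ℂ V] [LieRingModule g V] [LieModule ℂ g V]

variable (g) in
/-- The projection of `socⁱ⁺¹ V` onto the `i`-th socle factor. -/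
def lieSocleProj (i : ℕ) : lieSocleSeries ℂ g V (i + 1) →ₗ⁅ℂ, g⁆ LieSocleFactor ℂ g V i :=
  LieModuleHom.codRestrict (lieSocle ℂ g (V ⧸ lieSocleSeries ℂ g V i))
    ((LieSubmodule.Quotient.mk' (lieSocleSeries ℂ g V i)).comp
      (lieSocleSeries ℂ g V (i + 1)).incl) fun v => v.2

variable {V}

theorem coe_lieSocleProj (i : ℕ) (v : lieSocleSeries ℂ g V (i + 1)) :
    (lieSocleProj g V i v : V ⧸ lieSocleSeries ℂ g V i) =
      LieSubmodule.Quotient.mk' (lieSocleSeries ℂ g V i) (v : V) := rfl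

theorem lieSocleProj_surjective (i : ℕ) : Function.Surjective (lieSocleProj g V i) := by
  rintro ⟨u, hu⟩
  obtain ⟨v, rfl⟩ := LieSubmodule.Quotient.surjective_mk' _ u
  exact ⟨⟨v, hu⟩, rfl⟩

theorem lieSocleProj_eq_zero_iff (i : ℕ) (v : lieSocleSeries ℂ g V (i + 1)) :
    lieSocleProj g V i v = 0 ↔ (v : V) ∈ lieSocleSeries ℂ g V i := by
  rw [← LieSubmodule.Quotient.mk_eq_zero, ← coe_lieSocleProj, ZeroMemClass.coe_eq_zero]

theorem lieSocleSeries_le_succ (i : ℕ) :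
    lieSocleSeries ℂ g V i ≤ lieSocleSeries ℂ g V (i + 1) := by
  intro v hv
  change LieSubmodule.Quotient.mk' _ v ∈ lieSocle ℂ g _
  rw [(LieSubmodule.Quotient.mk_eq_zero _).mpr hv]
  exact zero_mem _

/-- On the socle `p` is the identity, hence commutes with all of `g`. This lets the defect descend
to the next socle factor. -/
theorem lie_defect_eq_zero {s : LieSubalgebra ℂ g} {i : ℕ}
    (p : (V ⧸ lieSocleSeries ℂ g V i) →ₗ⁅ℂ, s⁆ LieSocleFactor ℂ g V i)
    (hp : ∀ u : LieSocleFactor ℂ g V i, p (u : V ⧸ lieSocleSeries ℂ g V i) = u)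
    (u : V ⧸ lieSocleSeries ℂ g V i) (hu : u ∈ lieSocle ℂ g (V ⧸ lieSocleSeries ℂ g V i)) (x : g) :
    p ⁅x, u⁆ - ⁅x, p u⁆ = 0 := by
  have h1 := hp ⟨u, hu⟩
  have h2 := hp ⟨⁅x, u⁆, LieSubmodule.lie_mem _ hu⟩
  simp only at h1 h2
  rw [h1, h2, sub_eq_zero]
  rfl

/-- The map is the defect of an `s`-retraction `p` onto the socle of `V / socⁱ`. The formula
relating `f` to `p` is recorded because it identifies `f` with the graded action when `r` kills the
factors. -/
theorem exists_ne_zero_of_isUniserial [FiniteDimensional ℂ g] [FiniteDimensional ℂ V]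
    {s : LieSubalgebra ℂ g} (hLevi : IsLeviDecomposition g s) (hV : LieIsUniserial ℂ g V) (i : ℕ)
    {A B : Type*} [AddCommGroup A] [Module ℂ A] [LieRingModule s A] [LieModule ℂ s A]
    [AddCommGroup B] [Module ℂ B] [LieRingModule s B] [LieModule ℂ s B]
    [Nontrivial A] [Nontrivial B]
    (e₀ : LieSocleFactor ℂ g V i ≃ₗ⁅ℂ, s⁆ A) (e₁ : LieSocleFactor ℂ g V (i + 1) ≃ₗ⁅ℂ, s⁆ B) :
    ∃ f : LieAlgebra.radical ℂ g →ₗ⁅ℂ, s⁆ (B →ₗ[ℂ] A), f ≠ 0 ∧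
      ∃ p : (V ⧸ lieSocleSeries ℂ g V i) →ₗ⁅ℂ, s⁆ LieSocleFactor ℂ g V i,
        (∀ u : LieSocleFactor ℂ g V i, p (u : V ⧸ lieSocleSeries ℂ g V i) = u) ∧
        ∀ (x : LieAlgebra.radical ℂ g) (a : lieSocleSeries ℂ g V (i + 2)),
          f x (e₁ (lieSocleProj g V (i + 1) a)) =
            e₀ (p ⁅(x : g), LieSubmodule.Quotient.mk' (lieSocleSeries ℂ g V i) (a : V)⁆ -
              ⁅(x : g), p (LieSubmodule.Quotient.mk' (lieSocleSeries ℂ g V i) (a : V))⁆) := by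
  have := hLevi.isKilling
  have : FiniteDimensional ℂ (V ⧸ lieSocleSeries ℂ g V i) :=
    inferInstanceAs (FiniteDimensional ℂ (V ⧸ (lieSocleSeries ℂ g V i).toSubmodule))
  obtain ⟨p, hp⟩ := exists_leftInverse_of_injective
    ((lieSocle ℂ g (V ⧸ lieSocleSeries ℂ g V i)).incl.restrictLie s)
    (LieSubmodule.injective_incl _)
  replace hp : ∀ u : LieSocleFactor ℂ g V i, p (u : V ⧸ lieSocleSeries ℂ g V i) = u := hp
  obtain ⟨f, hf⟩ := LieModuleHom.exists_factor
    ((e₁ : _ →ₗ⁅ℂ, s⁆ B).comp ((lieSocleProj g V (i + 1)).restrictLie s))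
    (e₁.surjective.comp (lieSocleProj_surjective (i + 1)))
    ((LieModuleHom.postcomp (e₀ : _ →ₗ⁅ℂ, s⁆ A)).comp
      (LieModuleHom.defect s (LieAlgebra.radical ℂ g)
        ((LieSubmodule.Quotient.mk' (lieSocleSeries ℂ g V i)).comp
          (lieSocleSeries ℂ g V (i + 2)).incl) p))
    (fun x a ha => by
      have h1 : lieSocleProj g V (i + 1) a = 0 :=
        (LinearEquiv.map_eq_zero_iff e₁.toLinearEquiv).mp ha
      have h2 := lie_defect_eq_zero p hp _ ((lieSocleProj_eq_zero_iff _ _).mp h1) (x : g)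
      exact (congrArg e₀ h2).trans (LinearEquiv.map_zero e₀.toLinearEquiv))
  have hf' : ∀ (x : LieAlgebra.radical ℂ g) (a : lieSocleSeries ℂ g V (i + 2)),
      f x (e₁ (lieSocleProj g V (i + 1) a)) =
        e₀ (p ⁅(x : g), LieSubmodule.Quotient.mk' (lieSocleSeries ℂ g V i) (a : V)⁆ -
          ⁅(x : g), p (LieSubmodule.Quotient.mk' (lieSocleSeries ℂ g V i) (a : V))⁆) := hf
  refine ⟨f, fun h0 => ?_, p, hp, hf'⟩
  have hS : Nontrivial (LieSocleFactor ℂ g V i) := e₀.toLinearEquiv.toEquiv.nontrivial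
  obtain ⟨x, a, ha, hxa⟩ := hV.exists_defect_ne_zero hLevi
    (p.comp ((LieSubmodule.Quotient.mk' (lieSocleSeries ℂ g V i)).restrictLie s))
    (lieSocleSeries ℂ g V (i + 1)) (lieSocleSeries ℂ g V (i + 2))
    (fun c => by
      obtain ⟨b, rfl⟩ := lieSocleProj_surjective i c
      exact ⟨b, b.2, hp (lieSocleProj g V i b)⟩)
    (lieSocleSeries_le_succ _)
    (fun hle => by
      obtain ⟨b, hb⟩ := exists_ne (0 : B)
      obtain ⟨c, rfl⟩ := e₁.surjective b
      obtain ⟨v, rfl⟩ := lieSocleProj_surjective (i + 1) c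
      refine hb ?_
      rw [(lieSocleProj_eq_zero_iff _ _).mpr (hle v.2)]
      exact LinearEquiv.map_zero e₁.toLinearEquiv)
  refine hxa ((LinearEquiv.map_eq_zero_iff e₀.toLinearEquiv).mp ?_)
  have := hf' x ⟨a, ha⟩
  rw [h0] at this
  exact this.symm

/-- An abelian ideal of a perfect Lie algebra acts trivially on irreducible modules. -/
theorem LieModule.lie_eq_zero_of_isIrreducible_of_perfect [FiniteDimensional ℂ V]
    (hg : ⁅(⊤ : LieIdeal ℂ g), (⊤ : LieIdeal ℂ g)⁆ = ⊤) (I : LieIdeal ℂ g)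
    [LieAlgebra.IsSolvable I] [IsIrreducible ℂ g V] (x : I) (v : V) : ⁅(x : g), v⁆ = 0 := by
  have := nontrivial_of_isIrreducible ℂ g V
  -- Lie's theorem: a weight space of the ideal is `g`-stable, so the ideal acts by scalars.
  -- Perfectness makes their traces vanish.
  obtain ⟨χ, hχ⟩ := exists_nontrivial_weightSpace_of_isSolvable ℂ I V
  let N : LieSubmodule ℂ g V := weightSpaceOfIsLieTower ℂ V χ
  have hN' : Nontrivial N := hχ
  have hN : N = ⊤ := N.eq_top_of_isIrreducible ℂ g V
  have hx : ∀ w : V, ⁅(x : g), w⁆ = χ x • w := fun w => by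
    have hw : w ∈ N := hN ▸ LieSubmodule.mem_top w
    exact (mem_weightSpace χ w).mp hw x
  have htr : LinearMap.trace ℂ V (toEnd ℂ g V x) = 0 := by
    refine trace_toEnd_eq_zero_of_mem_lcs ℂ g V le_rfl ?_
    rw [lowerCentralSeries_succ, lowerCentralSeries_zero, hg]
    exact LieSubmodule.mem_top _
  have : toEnd ℂ g V x = χ x • LinearMap.id := by
    ext w
    simpa using hx w
  rw [this, map_smul, LinearMap.trace_id, smul_eq_mul, mul_eq_zero, Nat.cast_eq_zero] at htr
  rw [hx, htr.resolve_right Module.finrank_pos.ne', zero_smul]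

end Socle

/-! ### Superdiagonal endomorphisms -/

section Superdiagonal

attribute [local instance] LieRing.ofAssociativeRing

variable {n : ℕ} {W : Fin (n + 1) → Type*} [∀ i, AddCommGroup (W i)] [∀ i, Module ℂ (W i)]

@[simp]
theorem superdiagonal_apply_castSucc (h : ∀ i : Fin n, W i.succ →ₗ[ℂ] W i.castSucc) (w : ∀ i, W i)
    (i : Fin n) : superdiagonal h w i.castSucc = h i (w i.succ) := by
  simp only [superdiagonal, LinearMap.sum_apply, LinearMap.comp_apply, LinearMap.proj_apply,
    LinearMap.coe_single, Finset.sum_apply]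
  rw [Finset.sum_eq_single i _ (by simp)]
  · simp
  · intro j _ hj
    exact Pi.single_eq_of_ne (fun h => hj (Fin.castSucc_injective n h).symm) _

@[simp]
theorem superdiagonal_apply_last (h : ∀ i : Fin n, W i.succ →ₗ[ℂ] W i.castSucc) (w : ∀ i, W i) :
    superdiagonal h w (Fin.last n) = 0 := by
  simp only [superdiagonal, LinearMap.sum_apply, LinearMap.comp_apply, LinearMap.proj_apply,
    LinearMap.coe_single, Finset.sum_apply]
  exact Finset.sum_eq_zero fun j _ => Pi.single_eq_of_ne (Fin.castSucc_lt_last j).ne' _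

theorem superdiagonal_add (h h' : ∀ i : Fin n, W i.succ →ₗ[ℂ] W i.castSucc) :
    superdiagonal (fun i => h i + h' i) = superdiagonal h + superdiagonal h' := by
  refine LinearMap.ext fun w => funext fun k => ?_
  induction k using Fin.lastCases <;> simp

theorem superdiagonal_smul (t : ℂ) (h : ∀ i : Fin n, W i.succ →ₗ[ℂ] W i.castSucc) :
    superdiagonal (fun i => t • h i) = t • superdiagonal h := by
  refine LinearMap.ext fun w => funext fun k => ?_
  induction k using Fin.lastCases <;> simp

theorem superdiagonal_apply_eq_zero (h : ∀ i : Fin n, W i.succ →ₗ[ℂ] W i.castSucc)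
    (w : ∀ i, W i) (k : Fin (n + 1)) (hw : ∀ j : Fin (n + 1), (j : ℕ) = k + 1 → w j = 0) :
    superdiagonal h w k = 0 := by
  induction k using Fin.lastCases with
  | last => simp
  | cast i => rw [superdiagonal_apply_castSucc, hw i.succ (by simp), map_zero]

variable {s r : Type*} [LieRing s] [LieAlgebra ℂ s] [AddCommGroup r] [Module ℂ r]
  [LieRingModule s r] [LieModule ℂ s r] [∀ i, LieRingModule s (W i)] [∀ i, LieModule ℂ s (W i)]

omit [LieModule ℂ s r] in
-- This is the mixed relation between `s`, acting componentwise, and `r`, acting superdiagonally, in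
-- a semidirect product.
theorem superdiagonal_lie (f : ∀ i : Fin n, r →ₗ⁅ℂ, s⁆ (W i.succ →ₗ[ℂ] W i.castSucc)) (y : s) (x : r)
    (w : ∀ i, W i) :
    superdiagonal (fun i => f i ⁅y, x⁆) w =
      (fun k => ⁅y, superdiagonal (fun i => f i x) w k⁆) -
        superdiagonal (fun i => f i x) (fun k => ⁅y, w k⁆) := by
  funext k
  induction k using Fin.lastCases with
  | last => simp
  | cast i =>
    simp only [superdiagonal_apply_castSucc, Pi.sub_apply]
    rw [LieModuleHom.map_lie, LieHom.lie_apply]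

theorem isLieAbelian_superdiagonalLieAlgebra_iff
    (f : ∀ i : Fin n, r →ₗ⁅ℂ, s⁆ (W i.succ →ₗ[ℂ] W i.castSucc)) :
    IsLieAbelian (superdiagonalLieAlgebra f) ↔ ∀ (x y : r) (w : ∀ i, W i),
      superdiagonal (fun i => f i x) (superdiagonal (fun i => f i y) w) =
        superdiagonal (fun i => f i y) (superdiagonal (fun i => f i x) w) := by
  rw [superdiagonalLieAlgebra, LieSubalgebra.isLieAbelian_lieSpan_iff]
  constructor
  · intro h x y w
    have := h _ ⟨x, rfl⟩ _ ⟨y, rfl⟩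
    rw [LieRing.of_associative_ring_bracket, sub_eq_zero] at this
    exact LinearMap.congr_fun this w
  · rintro h _ ⟨x, rfl⟩ _ ⟨y, rfl⟩
    rw [LieRing.of_associative_ring_bracket, sub_eq_zero]
    exact LinearMap.ext (h x y)

end Superdiagonal

/-! ### Necessary conditions for admissibility -/

section Admissible

open LieModule

variable {g : Type*} [LieRing g] [LieAlgebra ℂ g] {s : LieSubalgebra ℂ g}

theorem LieModule.isIrreducible_of_lieSubalgebra_equiv {M A : Type*}
    [AddCommGroup M] [Module ℂ M] [LieRingModule g M] [LieModule ℂ g M]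
    [AddCommGroup A] [Module ℂ A] [LieRingModule s A] [LieModule ℂ s A]
    [IsIrreducible ℂ s A] (e : M ≃ₗ⁅ℂ, s⁆ A) : IsIrreducible ℂ g M := by
  have := nontrivial_of_isIrreducible ℂ s A
  have : Nontrivial M := e.toLinearEquiv.toEquiv.nontrivial
  refine IsIrreducible.mk fun N hN => ?_
  let Q : LieSubmodule ℂ s A :=
    { N.toSubmodule.map (e.toLinearEquiv : M →ₗ[ℂ] A) with
      lie_mem := fun {y a} ha => by
        obtain ⟨m, hm, rfl⟩ := ha
        exact ⟨⁅(y : g), m⁆, N.lie_mem hm, LieModuleHom.map_lie (e : M →ₗ⁅ℂ, s⁆ A) y m⟩ }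
  have hQ : ∀ m, e m ∈ Q ↔ m ∈ N := fun m =>
    ⟨fun ⟨m', hm', h⟩ => e.injective h ▸ hm', fun hm => ⟨m, hm, rfl⟩⟩
  rcases IsSimpleOrder.eq_bot_or_eq_top Q with h | h
  · refine absurd ((LieSubmodule.eq_bot_iff N).mpr fun m hm => ?_) hN
    have := (hQ m).mpr hm
    rw [h, LieSubmodule.mem_bot] at this
    exact (LinearEquiv.map_eq_zero_iff e.toLinearEquiv).mp this
  · rw [eq_top_iff]
    exact fun m _ => (hQ m).mp (h ▸ LieSubmodule.mem_top _)

variable [FiniteDimensional ℂ g] {n : ℕ} {W : Fin (n + 1) → Type*} [∀ i, AddCommGroup (W i)]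
  [∀ i, Module ℂ (W i)] [∀ i, LieRingModule s (W i)] [∀ i, LieModule ℂ s (W i)]
  [∀ i, LieModule.IsIrreducible ℂ s (W i)]

theorem IsAdmissibleSequence.exists_ne_zero (hLevi : IsLeviDecomposition g s)
    (h : IsAdmissibleSequence s W) (i : Fin n) :
    ∃ f : LieAlgebra.radical ℂ g →ₗ⁅ℂ, s⁆ (W i.succ →ₗ[ℂ] W i.castSucc), f ≠ 0 := by
  obtain ⟨V, _, _, _, _, _, hV, -, he⟩ := h
  obtain ⟨e₀⟩ := he i.castSucc
  obtain ⟨e₁⟩ := he i.succ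
  have := nontrivial_of_isIrreducible ℂ s (W i.castSucc)
  have := nontrivial_of_isIrreducible ℂ s (W i.succ)
  obtain ⟨f, hf, -⟩ := exists_ne_zero_of_isUniserial hLevi hV i e₀ e₁
  exact ⟨f, hf⟩

theorem IsAdmissibleSequence.exists_isLieAbelian (hLevi : IsLeviDecomposition g s)
    (hg : ⁅(⊤ : LieIdeal ℂ g), (⊤ : LieIdeal ℂ g)⁆ = ⊤) (hr : IsLieAbelian (LieAlgebra.radical ℂ g))
    (h : IsAdmissibleSequence s W) :
    ∃ f : ∀ i : Fin n, LieAlgebra.radical ℂ g →ₗ⁅ℂ, s⁆ (W i.succ →ₗ[ℂ] W i.castSucc),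
      (∀ i, f i ≠ 0) ∧ IsLieAbelian (superdiagonalLieAlgebra f) := by
  obtain ⟨V, _, _, _, _, _, hV, -, he⟩ := h
  let e : ∀ i : Fin (n + 1), LieSocleFactor ℂ g V i ≃ₗ⁅ℂ, s⁆ W i := fun i => (he i).some
  have hnt : ∀ i, Nontrivial (W i) := fun i => nontrivial_of_isIrreducible ℂ s (W i)
  have hzero : ∀ (i : Fin (n + 1)) (x : LieAlgebra.radical ℂ g) (u : LieSocleFactor ℂ g V i),
      ⁅(x : g), u⁆ = 0 := by
    intro i x u
    have := LieModule.isIrreducible_of_lieSubalgebra_equiv (g := g) (e i)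
    have : FiniteDimensional ℂ (V ⧸ lieSocleSeries ℂ g V i) :=
      inferInstanceAs (FiniteDimensional ℂ (V ⧸ (lieSocleSeries ℂ g V i).toSubmodule))
    exact lie_eq_zero_of_isIrreducible_of_perfect hg (LieAlgebra.radical ℂ g) x u
  have hmem : ∀ (i : Fin (n + 1)) (x : LieAlgebra.radical ℂ g), ∀ v ∈ lieSocleSeries ℂ g V (i + 1),
      ⁅(x : g), v⁆ ∈ lieSocleSeries ℂ g V i := by
    intro i x v hv
    have h1 := hzero i x (lieSocleProj g V i ⟨v, hv⟩)
    rw [← LieModuleHom.map_lie] at h1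
    exact (lieSocleProj_eq_zero_iff _ _).mp h1
  choose f hf p hp hfp using fun i : Fin n =>
    exists_ne_zero_of_isUniserial hLevi hV i (e i.castSucc) (e i.succ)
  have key : ∀ (i : Fin n) (x : LieAlgebra.radical ℂ g)
      (a : V) (ha : a ∈ lieSocleSeries ℂ g V (i + 2)),
      f i x (e i.succ (lieSocleProj g V (i + 1) ⟨a, ha⟩)) =
        e i.castSucc (lieSocleProj g V i ⟨⁅(x : g), a⁆, hmem i.succ x a ha⟩) := by
    intro i x a ha
    rw [hfp]
    congr 1
    rw [hzero i.castSucc, sub_zero]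
    exact hp i (lieSocleProj g V i ⟨⁅(x : g), a⁆, hmem i.succ x a ha⟩)
  refine ⟨f, hf, (isLieAbelian_superdiagonalLieAlgebra_iff f).mpr fun x y w => ?_⟩
  -- The vectors `a k ∈ socᵏ⁺¹` lift the components `w k`. Acting by `z` and shifting the index
  -- lifts the superdiagonal operator; the zeros beyond `n` account for the last component.
  let Rep : (ℕ → V) → (∀ i, W i) → Prop := fun a w =>
    (∀ k : Fin (n + 1), ∃ h : a k ∈ lieSocleSeries ℂ g V (k + 1),
      e k (lieSocleProj g V k ⟨a k, h⟩) = w k) ∧ ∀ k, n < k → a k = 0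
  have step : ∀ (z : LieAlgebra.radical ℂ g) (a : ℕ → V) (w : ∀ i, W i), Rep a w →
      Rep (fun k => ⁅(z : g), a (k + 1)⁆) (superdiagonal (fun i => f i z) w) := by
    rintro z a w ⟨h1, h2⟩
    refine ⟨fun k => ?_, fun k hk => ?_⟩
    · induction k using Fin.lastCases with
      | last =>
        have h3 : a (((Fin.last n : Fin (n + 1)) : ℕ) + 1) = 0 := h2 _ (by simp)
        have h4 : ⁅(z : g), a (((Fin.last n : Fin (n + 1)) : ℕ) + 1)⁆ = 0 := by rw [h3, lie_zero]
        have h5 : ⁅(z : g), a (((Fin.last n : Fin (n + 1)) : ℕ) + 1)⁆ ∈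
            lieSocleSeries ℂ g V ((Fin.last n : Fin (n + 1)) + 1) := by rw [h4]; exact zero_mem _
        refine ⟨h5, ?_⟩
        rw [superdiagonal_apply_last]
        refine (LinearEquiv.map_eq_zero_iff (e (Fin.last n)).toLinearEquiv).mpr ?_
        refine (lieSocleProj_eq_zero_iff _ _).mpr ?_
        simp only [h4, zero_mem]
      | cast i =>
        obtain ⟨h3, h4⟩ := h1 i.succ
        refine ⟨hmem i.succ z _ h3, ?_⟩
        rw [superdiagonal_apply_castSucc, ← h4]
        exact (key i z (a (i + 1)) h3).symm
    · simp only [h2 (k + 1) (by omega), lie_zero]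
  obtain ⟨a, ha⟩ : ∃ a, Rep a w := by
    choose v hv using fun k : Fin (n + 1) =>
      ((e k).surjective.comp (lieSocleProj_surjective (k : ℕ))) (w k)
    refine ⟨fun k => if h : k < n + 1 then v ⟨k, h⟩ else 0, fun k => ?_, fun k hk => ?_⟩
    · have hk : (if h : (k : ℕ) < n + 1 then (v ⟨k, h⟩ : V) else 0) = v k := dif_pos k.2
      refine ⟨by simp only [hk, SetLike.coe_mem], ?_⟩
      rw [← hv k]
      exact congrArg (fun u => e k (lieSocleProj g V k u)) (Subtype.ext hk)
    · exact dif_neg (by omega)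
  have h1 := step x (fun k => ⁅(y : g), a (k + 1)⁆) (superdiagonal (fun i => f i y) w)
    (step y a w ha)
  have h2 := step y (fun k => ⁅(x : g), a (k + 1)⁆) (superdiagonal (fun i => f i x) w)
    (step x a w ha)
  have hcomm : ∀ v : V, ⁅(x : g), ⁅(y : g), v⁆⁆ = ⁅(y : g), ⁅(x : g), v⁆⁆ := fun v => by
    have h0 : ⁅(x : g), (y : g)⁆ = 0 := congrArg Subtype.val (trivial_lie_zero _ _ x y)
    rw [leibniz_lie, h0, zero_lie, zero_add]
  funext k
  obtain ⟨h3, h4⟩ := h1.1 k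
  obtain ⟨h5, h6⟩ := h2.1 k
  rw [← h4, ← h6]
  congr 3
  exact hcomm _

end Admissible

/-! ### Construction of uniserial modules -/

section Construction

open LieModule

/-! ### Socle series read off from a chain of submodules -/

section Chain

variable {g : Type*} [LieRing g] [LieAlgebra ℂ g]
  {V : Type*} [AddCommGroup V] [Module ℂ V] [LieRingModule g V] [LieModule ℂ g V]

/-- If the submodules form the chain `0 = U 0 < ⋯ < U m = V`, then the socle series is `U`. -/
theorem lieSocleSeries_eq_of_chain {m : ℕ} (U : ℕ → LieSubmodule ℂ g V) (h0 : U 0 = ⊥)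
    (hlt : ∀ k < m, U k < U (k + 1)) (hall : ∀ N : LieSubmodule ℂ g V, ∃ k ≤ m, N = U k) (k : ℕ)
    (hk : k ≤ m) : lieSocleSeries ℂ g V k = U k := by
  have hmono : ∀ a b, a ≤ b → b ≤ m → U a ≤ U b := by
    intro a b hab hb
    induction b, hab using Nat.le_induction with
    | base => exact le_rfl
    | succ b _ ih => exact (ih (by omega)).trans (hlt b (by omega)).le
  induction k with
  | zero => exact h0.symm
  | succ k ih =>
    have ih := ih (by omega)
    change (lieSocle ℂ g (V ⧸ lieSocleSeries ℂ g V k)).comap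
      (LieSubmodule.Quotient.mk' (lieSocleSeries ℂ g V k)) = U (k + 1)
    rw [ih]
    let π := LieSubmodule.Quotient.mk' (U k)
    have hcomap : ∀ P : LieSubmodule ℂ g (V ⧸ U k), (P.comap π).map π = P := by
      intro P
      refine le_antisymm (LieSubmodule.map_comap_le _ _) fun q hq => ?_
      obtain ⟨v, rfl⟩ := LieSubmodule.Quotient.surjective_mk' _ q
      exact LieSubmodule.mem_map_of_mem (LieSubmodule.mem_comap.mpr hq)
    -- A non-zero `P` pulls back to some `U j` with `j > k`, so the image of `U (k + 1)` is the
    -- least non-zero submodule, hence the socle.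
    have hge : ∀ P : LieSubmodule ℂ g (V ⧸ U k), P ≠ ⊥ → (U (k + 1)).map π ≤ P := by
      intro P hP
      obtain ⟨j, hj, hPj⟩ := hall (P.comap π)
      rw [← hcomap P, hPj]
      refine LieSubmodule.map_mono (hmono _ _ ?_ hj)
      by_contra! hjk
      refine hP ?_
      rw [← hcomap P, hPj, LieSubmodule.Quotient.map_mk'_eq_bot_le]
      exact hmono _ _ (by omega) (by omega)
    have hne : (U (k + 1)).map π ≠ ⊥ := by
      rw [Ne, LieSubmodule.Quotient.map_mk'_eq_bot_le]
      exact not_le_of_gt (hlt k (by omega))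
    have hsoc : lieSocle ℂ g (V ⧸ U k) = (U (k + 1)).map π := by
      refine le_antisymm (sSup_le fun P hP => ?_) (le_sSup ?_)
      · have hP := (LieSubmodule.isIrreducible_iff_isAtom P).mp hP
        rcases hP.le_iff.mp (hge P hP.1) with h | h
        · exact absurd h hne
        · exact h.ge
      · refine (LieSubmodule.isIrreducible_iff_isAtom _).mpr ⟨hne, fun Q hQ => ?_⟩
        by_contra hQ0
        exact not_le_of_gt hQ (hge Q hQ0)
    rw [hsoc]
    refine le_antisymm (fun v hv => ?_) (fun v hv => LieSubmodule.mem_map_of_mem hv)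
    obtain ⟨u, hu, huv⟩ := (LieSubmodule.mem_map _).mp (LieSubmodule.mem_comap.mp hv)
    have h1 : v - u ∈ U k := by
      rw [← LieSubmodule.Quotient.mk_eq_zero, map_sub]
      exact sub_eq_zero.mpr huv.symm
    simpa using add_mem ((hlt k (by omega)).le h1) hu

theorem nonempty_lieSocleFactor_equiv {s : LieSubalgebra ℂ g} {A : Type*} [AddCommGroup A]
    [Module ℂ A] [LieRingModule s A] [LieModule ℂ s A] (i : ℕ)
    (β : lieSocleSeries ℂ g V (i + 1) →ₗ⁅ℂ, s⁆ A) (hβ : Function.Surjective β)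
    (hker : ∀ w : lieSocleSeries ℂ g V (i + 1), (w : V) ∈ lieSocleSeries ℂ g V i ↔ β w = 0) :
    Nonempty (LieSocleFactor ℂ g V i ≃ₗ⁅ℂ, s⁆ A) := by
  let α : lieSocleSeries ℂ g V (i + 1) →ₗ⁅ℂ, s⁆ LieSocleFactor ℂ g V i :=
    (lieSocleProj g V i).restrictLie s
  have hα : Function.Surjective α :=
    lieSocleProj_surjective (g := g) (V := V) i
  have hk : ∀ w, α w = 0 ↔ β w = 0 := fun w => by
    have h : lieSocleProj g V i w = 0 ↔ (w : V) ∈ lieSocleSeries ℂ g V i :=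
      lieSocleProj_eq_zero_iff i w
    exact h.trans (hker w)
  exact LieModuleHom.nonempty_equiv_of_ker_eq α hα β hβ hk

end Chain

variable {g : Type*} [LieRing g] [LieAlgebra ℂ g] {s : LieSubalgebra ℂ g} {n : ℕ}
  {W : Fin (n + 1) → Type*} [∀ i, AddCommGroup (W i)]
  [∀ i, Module ℂ (W i)] [∀ i, LieRingModule s (W i)] [∀ i, LieModule ℂ s (W i)]

/-- The Leibniz rule splits by type: `s` with `r` is the equivariance of the `f i`, and for two
elements of `r` both the bracket and the commutator of operators vanish. -/
theorem exists_lieModule_of_isLieAbelian (hLevi : IsLeviDecomposition g s)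
    (hr : IsLieAbelian (LieAlgebra.radical ℂ g))
    (f : ∀ i : Fin n, LieAlgebra.radical ℂ g →ₗ⁅ℂ, s⁆ (W i.succ →ₗ[ℂ] W i.castSucc))
    (hf : IsLieAbelian (superdiagonalLieAlgebra f)) :
    ∃ (_ : LieRingModule g (∀ i, W i)) (_ : LieModule ℂ g (∀ i, W i)),
      (∀ (y : s) (w : ∀ i, W i) (i : Fin (n + 1)), ⁅(y : g), w⁆ i = ⁅y, w i⁆) ∧
      ∀ (x : LieAlgebra.radical ℂ g) (w : ∀ i, W i),
        ⁅(x : g), w⁆ = superdiagonal (fun i => f i x) w := by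
  rw [isLieAbelian_superdiagonalLieAlgebra_iff] at hf
  let P : g →ₗ[ℂ] s := s.toSubmodule.projectionOnto _ hLevi.isCompl
  let Q : g →ₗ[ℂ] LieAlgebra.radical ℂ g := Submodule.projectionOnto _ _ hLevi.isCompl.symm
  have hPs : ∀ y : s, P y = y := fun y => Submodule.projectionOnto_apply_left _ y
  have hPr : ∀ x : LieAlgebra.radical ℂ g, P x = 0 :=
    fun x => Submodule.projectionOnto_apply_right _ x
  have hQr : ∀ x : LieAlgebra.radical ℂ g, Q x = x :=
    fun x => Submodule.projectionOnto_apply_left _ x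
  have hQs : ∀ y : s, Q y = 0 := fun y => Submodule.projectionOnto_apply_right _ y
  let F : LieAlgebra.radical ℂ g → Module.End ℂ (∀ i, W i) := fun x => superdiagonal fun i => f i x
  have hFadd : ∀ x x', F (x + x') = F x + F x' := fun x x' => by
    simp only [F, map_add]
    exact superdiagonal_add _ _
  have hFsmul : ∀ (t : ℂ) x, F (t • x) = t • F x := fun t x => by
    simp only [F, map_smul]
    exact superdiagonal_smul _ _
  let D : s → (∀ i, W i) → (∀ i, W i) := fun y w i => ⁅y, w i⁆
  have hDadd : ∀ y w w', D y (w + w') = D y w + D y w' := fun y w w' => funext fun i => lie_add _ _ _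
  have hDadd' : ∀ y y' w, D (y + y') w = D y w + D y' w :=
    fun y y' w => funext fun i => add_lie _ _ _
  have hDlie : ∀ y y' w, D ⁅y, y'⁆ w = D y (D y' w) - D y' (D y w) :=
    fun y y' w => funext fun i => lie_lie _ _ _
  have hFlie : ∀ y x w, F ⁅y, x⁆ w = D y (F x w) - F x (D y w) := superdiagonal_lie f
  have hFcomm : ∀ x x' w, F x (F x' w) = F x' (F x w) := hf
  have hP : ∀ (y : s) (x : LieAlgebra.radical ℂ g), P (y + x) = y := fun y x => by
    rw [map_add, hPs, hPr, add_zero]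
  have hQ : ∀ (y : s) (x : LieAlgebra.radical ℂ g), Q (y + x) = x := fun y x => by
    rw [map_add, hQs, hQr, zero_add]
  have hbracket : ∀ (y y' : s) (x x' : LieAlgebra.radical ℂ g), ⁅(y : g) + x, (y' : g) + x'⁆ =
      ((⁅y, y'⁆ : s) : g) + ((⁅y, x'⁆ - ⁅y', x⁆ : LieAlgebra.radical ℂ g) : g) := by
    intro y y' x x'
    have h0 : ⁅(x : g), (x' : g)⁆ = 0 := congrArg Subtype.val (trivial_lie_zero _ _ x x')
    have h1 : ((⁅y, x'⁆ - ⁅y', x⁆ : LieAlgebra.radical ℂ g) : g) =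
      ⁅(y : g), (x' : g)⁆ - ⁅(y' : g), (x : g)⁆ := rfl
    rw [h1, LieSubalgebra.coe_bracket, lie_add, add_lie, add_lie, h0, ← lie_skew (y' : g) (x : g)]
    abel
  let inst : LieRingModule g (∀ i, W i) :=
    { bracket := fun z w => D (P z) w + F (Q z) w
      add_lie := fun z z' w => by
        change D (P (z + z')) w + F (Q (z + z')) w = D (P z) w + F (Q z) w + (D (P z') w + F (Q z') w)
        rw [map_add, map_add, hDadd', hFadd, LinearMap.add_apply]
        abel
      lie_add := fun z w w' => by
        change D (P z) (w + w') + F (Q z) (w + w') = D (P z) w + F (Q z) w + (D (P z) w' + F (Q z) w')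
        rw [hDadd, map_add]
        abel
      leibniz_lie := fun z z' w => by
        obtain ⟨y, x, rfl⟩ := hLevi.exists_add_eq z
        obtain ⟨y', x', rfl⟩ := hLevi.exists_add_eq z'
        change D (P (y + x)) (D (P (y' + x')) w + F (Q (y' + x')) w) +
          F (Q (y + x)) (D (P (y' + x')) w + F (Q (y' + x')) w) =
          D (P ⁅(y : g) + x, (y' : g) + x'⁆) w + F (Q ⁅(y : g) + x, (y' : g) + x'⁆) w +
          (D (P (y' + x')) (D (P (y + x)) w + F (Q (y + x)) w) +
            F (Q (y' + x')) (D (P (y + x)) w + F (Q (y + x)) w))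
        rw [hbracket]
        simp only [hP, hQ, hDadd, map_add]
        rw [sub_eq_add_neg, hFadd, LinearMap.add_apply, ← neg_one_smul ℂ, hFsmul,
          LinearMap.smul_apply, neg_one_smul, hFlie, hFlie, hDlie, hFcomm x x']
        abel }
  have hbr : ∀ (z : g) (w : ∀ i, W i), ⁅z, w⁆ = D (P z) w + F (Q z) w := fun _ _ => rfl
  refine ⟨inst, { smul_lie := fun t z w => ?_, lie_smul := fun t z w => ?_ },
    fun y w i => ?_, fun x w => ?_⟩
  · rw [hbr, hbr, map_smul, map_smul, hFsmul, smul_add, LinearMap.smul_apply]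
    congr 1
    exact funext fun i => smul_lie _ _ _
  · rw [hbr, hbr, map_smul, smul_add]
    congr 1
    exact funext fun i => lie_smul _ _ _
  · rw [hbr, hPs, hQs, show F 0 = 0 by simpa using hFsmul 0 0]
    simp [D]
  · rw [hbr, hPr, hQr]
    have : D 0 w = 0 := funext fun i => zero_lie _
    rw [this, zero_add]

/-! ### Submodules of the superdiagonal module -/

section Filtration

variable [LieRingModule g (∀ i, W i)] [LieModule ℂ g (∀ i, W i)]
  (hLevi : IsLeviDecomposition g s)
  (f : ∀ i : Fin n, LieAlgebra.radical ℂ g →ₗ⁅ℂ, s⁆ (W i.succ →ₗ[ℂ] W i.castSucc))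
  (hs : ∀ (y : s) (w : ∀ i, W i) (i : Fin (n + 1)), ⁅(y : g), w⁆ i = ⁅y, w i⁆)
  (hr : ∀ (x : LieAlgebra.radical ℂ g) (w : ∀ i, W i),
    ⁅(x : g), w⁆ = superdiagonal (fun i => f i x) w)

/-- The submodule `W 0 ⊕ ⋯ ⊕ W (k - 1)` of a module on which the radical acts by superdiagonal
endomorphisms. -/
def superdiagonalFiltration (k : ℕ) : LieSubmodule ℂ g (∀ i, W i) where
  carrier := {w | ∀ i : Fin (n + 1), k ≤ i → w i = 0}
  add_mem' ha hb i hi := by simp [ha i hi, hb i hi]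
  zero_mem' i _ := rfl
  smul_mem' t a ha i hi := by simp [ha i hi]
  lie_mem {z a} ha i hi := by
    obtain ⟨y, x, rfl⟩ := hLevi.exists_add_eq z
    rw [add_lie, Pi.add_apply, hs, ha i hi, lie_zero, hr, zero_add]
    exact superdiagonal_apply_eq_zero _ _ _ fun j hj => ha j (by omega)

omit [LieModule ℂ g (∀ i, W i)] in
theorem superdiagonalFiltration_lt [∀ i, Nontrivial (W i)] {k : ℕ} (hk : k < n + 1) :
    superdiagonalFiltration hLevi f hs hr k < superdiagonalFiltration hLevi f hs hr (k + 1) := by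
  classical
  refine lt_of_le_not_ge (fun w hw i hi => hw i (by omega)) fun h => ?_
  obtain ⟨a, ha⟩ := exists_ne (0 : W ⟨k, hk⟩)
  have h1 : Pi.single (⟨k, hk⟩ : Fin (n + 1)) a ∈ superdiagonalFiltration hLevi f hs hr (k + 1) := by
    intro i hi
    refine Pi.single_eq_of_ne (fun h => ?_) _
    rw [h] at hi
    simp at hi
  have h2 := h h1 ⟨k, hk⟩ le_rfl
  rw [Pi.single_eq_same] at h2
  exact ha h2

omit [LieModule ℂ g (∀ i, W i)] in
-- The leading components of vectors of `N` at level `i` form an `s`-submodule of the irreducible `W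
-- i`, so one non-zero value yields all.
theorem exists_mem_superdiagonalFiltration_eq [∀ i, IsIrreducible ℂ s (W i)]
    (N : LieSubmodule ℂ g (∀ i, W i)) (i : Fin (n + 1))
    (h : ∃ v ∈ N, v ∈ superdiagonalFiltration hLevi f hs hr (i + 1) ∧ v i ≠ 0) (a : W i) :
    ∃ v ∈ N, v ∈ superdiagonalFiltration hLevi f hs hr (i + 1) ∧ v i = a := by
  let U := superdiagonalFiltration hLevi f hs hr (i + 1)
  let T : LieSubmodule ℂ s (W i) :=
    { (N ⊓ U : LieSubmodule ℂ g _).toSubmodule.map (LinearMap.proj i : (∀ i, W i) →ₗ[ℂ] W i) with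
      lie_mem := fun {y a} ha => by
        obtain ⟨v, hv, rfl⟩ := ha
        exact ⟨⁅(y : g), v⁆, LieSubmodule.lie_mem _ hv, hs y v i⟩ }
  have hT : T = ⊤ := by
    refine (IsSimpleOrder.eq_bot_or_eq_top T).resolve_left fun hbot => ?_
    obtain ⟨v, hv, hvU, hvi⟩ := h
    have : v i ∈ T := ⟨v, ⟨hv, hvU⟩, rfl⟩
    rw [hbot, LieSubmodule.mem_bot] at this
    exact hvi this
  obtain ⟨v, ⟨hv, hvU⟩, hvi⟩ : a ∈ T := hT ▸ LieSubmodule.mem_top a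
  exact ⟨v, hv, hvU, hvi⟩

omit [LieModule ℂ g (∀ i, W i)] in
theorem exists_eq_superdiagonalFiltration [∀ i, IsIrreducible ℂ s (W i)] (hf : ∀ i, f i ≠ 0)
    (N : LieSubmodule ℂ g (∀ i, W i)) :
    ∃ k ≤ n + 1, N = superdiagonalFiltration hLevi f hs hr k := by
  classical
  set U := superdiagonalFiltration hLevi f hs hr with hU
  have hex : ∃ k, N ≤ U k := ⟨n + 1, fun w _ i hi => absurd i.2 (by omega)⟩
  obtain ⟨k, hk, hmin⟩ : ∃ k, N ≤ U k ∧ ∀ j < k, ¬ N ≤ U j :=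
    ⟨Nat.find hex, Nat.find_spec hex, fun j hj => Nat.find_min hex hj⟩
  have hkn : k ≤ n + 1 := by
    by_contra! h
    exact hmin (n + 1) h fun w _ i hi => absurd i.2 (by omega)
  -- Here `d` is the descent from the top level `k - 1`, where minimality of `k` supplies a vector.
  -- Below it, a non-zero value of `f j` carries a leading component from level `j + 1` to level
  -- `j`.
  have hall : ∀ d (i : Fin (n + 1)), (i : ℕ) + d + 1 = k → ∀ a, ∃ v ∈ N, v ∈ U (i + 1) ∧ v i = a := by
    intro d
    induction d with
    | zero =>
      intro i hi
      refine exists_mem_superdiagonalFiltration_eq hLevi f hs hr N i ?_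
      obtain ⟨v, hv, hvU⟩ := Set.not_subset.mp (hmin i (by omega))
      have hvk : v ∈ U (i + 1) := by
        rw [show (i : ℕ) + 1 = k by omega]
        exact hk hv
      refine ⟨v, hv, hvk, fun hvi => hvU fun j hj => ?_⟩
      rcases hj.eq_or_lt with h | h
      · rwa [← Fin.ext h]
      · exact hvk j h
    | succ d ih =>
      intro i hi
      refine exists_mem_superdiagonalFiltration_eq hLevi f hs hr N i ?_
      obtain ⟨j, rfl⟩ : ∃ j : Fin n, j.castSucc = i := ⟨⟨i, by omega⟩, rfl⟩
      have hfj := hf j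
      obtain ⟨x, hx⟩ : ∃ x, f j x ≠ 0 := by
        by_contra! h
        exact hfj (LieModuleHom.ext h)
      obtain ⟨a, ha⟩ : ∃ a, f j x a ≠ 0 := by
        by_contra! h
        exact hx (LinearMap.ext h)
      obtain ⟨v, hv, hvU, rfl⟩ := ih j.succ (by simp at hi ⊢; omega) a
      refine ⟨⁅(x : g), v⁆, N.lie_mem hv, fun l hl => ?_, ?_⟩
      · rw [hr]
        exact superdiagonal_apply_eq_zero _ _ _ fun m hm => hvU m (by simp at hl ⊢; omega)
      · rwa [hr, superdiagonal_apply_castSucc]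
  -- Triangular elimination: subtract a vector of `N` with the same leading component.
  have hle : ∀ j ≤ k, U j ≤ N := by
    intro j
    induction j with
    | zero =>
      intro _ w hw
      rw [show w = 0 from funext fun i => hw i (Nat.zero_le _)]
      exact zero_mem _
    | succ j ih =>
      intro hj w hw
      have hjn : j < n + 1 := by omega
      obtain ⟨v, hv, hvU, hvj⟩ := hall (k - j - 1) ⟨j, hjn⟩ (by simp; omega) (w ⟨j, hjn⟩)
      have : w - v ∈ U j := by
        intro i hi
        rcases hi.eq_or_lt with h | h
        · obtain rfl : i = ⟨j, hjn⟩ := Fin.ext h.symm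
          rw [Pi.sub_apply, hvj, sub_self]
        · rw [Pi.sub_apply, hw i h, hvU i h, sub_self]
      simpa using add_mem (ih (by omega) this) hv
  exact ⟨k, hkn, le_antisymm hk (hle k le_rfl)⟩

end Filtration

theorem isAdmissibleSequence_of_isLieAbelian [∀ i, FiniteDimensional ℂ (W i)]
    [∀ i, IsIrreducible ℂ s (W i)] (hLevi : IsLeviDecomposition g s)
    (hr : IsLieAbelian (LieAlgebra.radical ℂ g))
    (f : ∀ i : Fin n, LieAlgebra.radical ℂ g →ₗ⁅ℂ, s⁆ (W i.succ →ₗ[ℂ] W i.castSucc))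
    (hf0 : ∀ i, f i ≠ 0) (hf : IsLieAbelian (superdiagonalLieAlgebra f)) :
    IsAdmissibleSequence s W := by
  classical
  have hnt : ∀ i, Nontrivial (W i) := fun i => nontrivial_of_isIrreducible ℂ s (W i)
  obtain ⟨_, _, hs, hrad⟩ := exists_lieModule_of_isLieAbelian hLevi hr f hf
  let U := superdiagonalFiltration hLevi f hs hrad
  have hmem : ∀ k w, w ∈ U k ↔ ∀ i : Fin (n + 1), k ≤ i → w i = 0 := fun _ _ => Iff.rfl
  have hall := exists_eq_superdiagonalFiltration hLevi f hs hrad hf0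
  have hser := lieSocleSeries_eq_of_chain U
    ((LieSubmodule.eq_bot_iff _).mpr fun w hw => funext fun i => hw i (Nat.zero_le _))
    (fun k hk => superdiagonalFiltration_lt hLevi f hs hrad hk) hall
  refine ⟨∀ i, W i, inferInstance, inferInstance, inferInstance, inferInstance, inferInstance,
    fun N₁ N₂ => ?_, ?_, fun i => ?_⟩
  · obtain ⟨a, -, rfl⟩ := hall N₁
    obtain ⟨b, -, rfl⟩ := hall N₂
    rcases le_total a b with h | h
    · exact Or.inl fun w hw i hi => hw i (h.trans hi)
    · exact Or.inr fun w hw i hi => hw i (h.trans hi)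
  · rw [hser (n + 1) le_rfl, eq_top_iff]
    exact fun w _ i hi => absurd i.2 (by omega)
  · let β : lieSocleSeries ℂ g (∀ i, W i) (i + 1) →ₗ⁅ℂ, s⁆ W i :=
      { (LinearMap.proj i : (∀ i, W i) →ₗ[ℂ] W i) ∘ₗ
          (lieSocleSeries ℂ g (∀ i, W i) (i + 1)).toSubmodule.subtype with
        map_lie' := fun {y w} => hs y w i }
    refine nonempty_lieSocleFactor_equiv (i : ℕ) β (fun a => ?_) (fun w => ?_)
    · refine ⟨⟨Pi.single i a, ?_⟩, Pi.single_eq_same i a⟩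
      rw [hser (i + 1) (by omega)]
      exact fun j hj => Pi.single_eq_of_ne (by rintro rfl; omega) _
    · have hw : (w : ∀ i, W i) ∈ U (i + 1) := by
        rw [← hser (i + 1) (by omega)]
        exact w.2
      change (w : ∀ i, W i) ∈ _ ↔ (w : ∀ i, W i) i = 0
      rw [hser i (by omega)]
      refine ⟨fun h => h i le_rfl, fun h j hj => ?_⟩
      rcases hj.eq_or_lt with h' | h'
      · rwa [← Fin.ext h']
      · exact hw j h'

end Construction

/-! ### Commutators and the exterior square -/

section ExteriorSquare

variable {n : ℕ} {W : Fin (n + 1) → Type*} [∀ i, AddCommGroup (W i)] [∀ i, Module ℂ (W i)]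
  {s r : Type*} [LieRing s] [LieAlgebra ℂ s] [AddCommGroup r] [Module ℂ r]
  [LieRingModule s r] [LieModule ℂ s r] [∀ i, LieRingModule s (W i)] [∀ i, LieModule ℂ s (W i)]
  (f : ∀ i : Fin n, r →ₗ⁅ℂ, s⁆ (W i.succ →ₗ[ℂ] W i.castSucc))

/-- The linear map `x ↦ ∑ f i x`. -/
noncomputable def superdiagonalMap : r →ₗ[ℂ] Module.End ℂ (∀ i, W i) where
  toFun x := superdiagonal fun i => f i x
  map_add' x y := by simp only [map_add]; exact superdiagonal_add _ _
  map_smul' t x := by simp only [map_smul]; exact superdiagonal_smul _ _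

omit [LieModule ℂ s r] in
theorem superdiagonalMap_lie (y : s) (x : r) (w : ∀ i, W i) :
    superdiagonalMap f ⁅y, x⁆ w = (fun k => ⁅y, superdiagonalMap f x w k⁆) -
      superdiagonalMap f x (fun k => ⁅y, w k⁆) :=
  superdiagonal_lie f y x w

/-- The `(i, j)` block of the commutator of two superdiagonal endomorphisms. -/
noncomputable def superdiagonalCommutator (i j : Fin (n + 1)) :
    r [⋀^Fin 2]→ₗ[ℂ] (W j →ₗ[ℂ] W i) where
  toFun v := LinearMap.proj i ∘ₗ (superdiagonalMap f (v 0) * superdiagonalMap f (v 1) -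
    superdiagonalMap f (v 1) * superdiagonalMap f (v 0)) ∘ₗ LinearMap.single ℂ W j
  map_update_add' := by
    intro _ v k a b
    ext c
    fin_cases k <;> simp [Function.update, add_mul, mul_add] <;> abel
  map_update_smul' := by
    intro _ v k t a
    ext c
    fin_cases k <;> simp [Function.update, smul_sub]
  map_eq_zero_of_eq' := by
    intro v a b hv hab
    have h01 : v 0 = v 1 := by
      fin_cases a <;> fin_cases b <;> simp_all
    simp [h01]

omit [LieModule ℂ s r] in
theorem superdiagonalCommutator_apply (i j : Fin (n + 1)) (x y : r) (a : W j) :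
    superdiagonalCommutator f i j ![x, y] a =
      superdiagonalMap f x (superdiagonalMap f y (Pi.single j a)) i -
        superdiagonalMap f y (superdiagonalMap f x (Pi.single j a)) i := rfl

omit [LieModule ℂ s r] in
-- The Leibniz rule for commutators; it makes the block an `s`-map on `Λ² r`.
theorem lie_superdiagonalCommutator (i j : Fin (n + 1)) (z : s) (x y : r) :
    ⁅z, superdiagonalCommutator f i j ![x, y]⁆ =
      superdiagonalCommutator f i j ![⁅z, x⁆, y] + superdiagonalCommutator f i j ![x, ⁅z, y⁆] := by
  ext a
  have h1 : (fun k => ⁅z, (Pi.single j a : ∀ i, W i) k⁆) = Pi.single j ⁅z, a⁆ := by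
    funext k
    exact (Pi.apply_single (fun _ b => ⁅z, b⁆) (fun _ => lie_zero z) j a k)
  rw [LieHom.lie_apply, LinearMap.add_apply]
  simp only [superdiagonalCommutator_apply, superdiagonalMap_lie, map_sub, Pi.sub_apply, lie_sub,
    h1]
  abel

/-- The commutator block as a homomorphism on the exterior square. -/
noncomputable def superdiagonalCommutatorHom (i j : Fin (n + 1)) :
    (⋀[ℂ]^2 r) →ₗ⁅ℂ, s⁆ (W j →ₗ[ℂ] W i) :=
  { exteriorPower.alternatingMapLinearEquiv (superdiagonalCommutator f i j) with
    map_lie' := fun {z m} => by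
      let E : (⋀[ℂ]^2 r) →ₗ[ℂ] (W j →ₗ[ℂ] W i) :=
        exteriorPower.alternatingMapLinearEquiv (superdiagonalCommutator f i j)
      have : E ∘ₗ LieExteriorSquare.act ℂ z =
          (LieModule.toEnd ℂ s (W j →ₗ[ℂ] W i) z : _ →ₗ[ℂ] _) ∘ₗ E := by
        ext v : 2
        have hv : v = ![v 0, v 1] := by ext k; fin_cases k <;> rfl
        rw [LinearMap.compAlternatingMap_apply, LinearMap.compAlternatingMap_apply,
          LinearMap.comp_apply, LinearMap.comp_apply, LieExteriorSquare.act_wedge, map_add]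
        simp only [E, exteriorPower.alternatingMapLinearEquiv_apply_ιMulti]
        conv_rhs => rw [hv]
        exact (lie_superdiagonalCommutator f i j z (v 0) (v 1)).symm
      exact LinearMap.congr_fun this m }

theorem superdiagonalCommutatorHom_wedge (i j : Fin (n + 1)) (x y : r) :
    superdiagonalCommutatorHom f i j (exteriorPower.ιMulti ℂ 2 ![x, y]) =
      superdiagonalCommutator f i j ![x, y] :=
  exteriorPower.alternatingMapLinearEquiv_apply_ιMulti _ _

/-- A product of two superdiagonal operators lowers the index by exactly two, so only the blocks
with `j = i + 2` need the disjointness hypothesis. -/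
theorem isLieAbelian_superdiagonalLieAlgebra_of_disjoint [FiniteDimensional ℂ s]
    [LieAlgebra.IsKilling ℂ s] [FiniteDimensional ℂ r] [∀ i, FiniteDimensional ℂ (W i)]
    (h : ∀ i j : Fin (n + 1), (j : ℕ) = i + 2 →
      LieModulesDisjoint ℂ s (⋀[ℂ]^2 r) (Module.Dual ℂ (W j) ⊗[ℂ] W i)) :
    IsLieAbelian (superdiagonalLieAlgebra f) := by
  rw [isLieAbelian_superdiagonalLieAlgebra_iff]
  intro x y w
  change superdiagonalMap f x (superdiagonalMap f y w) =
    superdiagonalMap f y (superdiagonalMap f x w)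
  have hvan : ∀ (i j : Fin (n + 1)) (x y : r) (a : W j), (j : ℕ) ≠ i + 2 →
      superdiagonalMap f x (superdiagonalMap f y (Pi.single j a)) i = 0 := by
    intro i j x y a hij
    refine superdiagonal_apply_eq_zero _ _ _ fun k hk => ?_
    refine superdiagonal_apply_eq_zero _ _ _ fun l hl => Pi.single_eq_of_ne ?_ _
    rintro rfl
    omega
  have hcomm : superdiagonalMap f x ∘ₗ superdiagonalMap f y =
      superdiagonalMap f y ∘ₗ superdiagonalMap f x := by
    refine LinearMap.pi_ext fun j a => funext fun i => ?_
    change superdiagonalMap f x (superdiagonalMap f y (Pi.single j a)) i =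
      superdiagonalMap f y (superdiagonalMap f x (Pi.single j a)) i
    by_cases hij : (j : ℕ) = i + 2
    · have h0 : superdiagonalCommutatorHom f i j = 0 := by
        by_contra hne
        exact not_lieModulesDisjoint_dual_tensor_iff.mpr ⟨_, hne⟩ (h i j hij)
      have h1 := superdiagonalCommutatorHom_wedge f i j x y
      rw [h0] at h1
      exact (sub_eq_zero.mp (LinearMap.congr_fun h1 a).symm)
    · rw [hvan i j x y a hij, hvan i j y x a hij]
  exact LinearMap.congr_fun hcomm w

end ExteriorSquare

theorem mainTheorem9 {g : Type*} [LieRing g] [LieAlgebra ℂ g] [FiniteDimensional ℂ g]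
    (s : LieSubalgebra ℂ g) (hLevi : IsLeviDecomposition g s)
    (n : ℕ) (W : Fin (n + 1) → Type*) [∀ i, AddCommGroup (W i)] [∀ i, Module ℂ (W i)]
    [∀ i, FiniteDimensional ℂ (W i)] [∀ i, LieRingModule s (W i)] [∀ i, LieModule ℂ s (W i)]
    [∀ i, LieModule.IsIrreducible ℂ s (W i)] :
    (IsAdmissibleSequence s W →
      (∀ i : Fin n, ¬ LieModulesDisjoint ℂ s (LieAlgebra.radical ℂ g)
        (Module.Dual ℂ (W i.succ) ⊗[ℂ] W i.castSucc)) ∧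
      (LieModule.IsIrreducible ℂ s (LieAlgebra.radical ℂ g) →
        ∀ i : Fin n, ∃ Q : LieSubmodule ℂ s (Module.Dual ℂ (W i.succ) ⊗[ℂ] W i.castSucc),
          Nonempty (LieAlgebra.radical ℂ g ≃ₗ⁅ℂ, s⁆ Q))) ∧
    (⁅(⊤ : LieIdeal ℂ g), (⊤ : LieIdeal ℂ g)⁆ = ⊤ → IsLieAbelian (LieAlgebra.radical ℂ g) →
      (IsAdmissibleSequence s W ↔
        (∀ i : Fin n, ¬ LieModulesDisjoint ℂ s (LieAlgebra.radical ℂ g)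
          (Module.Dual ℂ (W i.succ) ⊗[ℂ] W i.castSucc)) ∧
        ∃ f : ∀ i : Fin n,
            LieAlgebra.radical ℂ g →ₗ⁅ℂ, s⁆ (W i.succ →ₗ[ℂ] W i.castSucc),
          (∀ i, f i ≠ 0) ∧ IsLieAbelian (superdiagonalLieAlgebra f)) ∧
      ((∀ i j : Fin (n + 1), (j : ℕ) = i + 2 →
          LieModulesDisjoint ℂ s (⋀[ℂ]^2 (LieAlgebra.radical ℂ g))
            (Module.Dual ℂ (W j) ⊗[ℂ] W i)) →
        (∀ i : Fin n, ¬ LieModulesDisjoint ℂ s (LieAlgebra.radical ℂ g)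
          (Module.Dual ℂ (W i.succ) ⊗[ℂ] W i.castSucc)) →
        IsAdmissibleSequence s W)) := by
  have := hLevi.isKilling
  have hdisj : ∀ i : Fin n, ¬ LieModulesDisjoint ℂ s (LieAlgebra.radical ℂ g)
      (Module.Dual ℂ (W i.succ) ⊗[ℂ] W i.castSucc) ↔
      ∃ f : LieAlgebra.radical ℂ g →ₗ⁅ℂ, s⁆ (W i.succ →ₗ[ℂ] W i.castSucc), f ≠ 0 :=
    fun i => not_lieModulesDisjoint_dual_tensor_iff
  refine ⟨fun h => ⟨fun i => (hdisj i).mpr (h.exists_ne_zero hLevi i), fun hirr i => ?_⟩,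
    fun hg hr => ⟨⟨fun h => ⟨fun i => (hdisj i).mpr (h.exists_ne_zero hLevi i),
      h.exists_isLieAbelian hLevi hg hr⟩, ?_⟩, fun hΛ hd => ?_⟩⟩
  · obtain ⟨f, hf⟩ := not_lieModulesDisjoint_iff.mp ((hdisj i).mpr (h.exists_ne_zero hLevi i))
    exact ⟨f.range, f.nonempty_equiv_range (f.injective_of_ne_zero hf)⟩
  · rintro ⟨-, f, hf0, hf⟩
    exact isAdmissibleSequence_of_isLieAbelian hLevi hr f hf0 hf
  · choose f hf using fun i => (hdisj i).mp (hd i)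
    exact isAdmissibleSequence_of_isLieAbelian hLevi hr f hf
      (isLieAbelian_superdiagonalLieAlgebra_of_disjoint f hΛ)
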